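/- **Lemma (Backtracking).** Let $T>0$, $x_0\in\mathbb R^n$, and let $f_1,\dots,f_N:\mathbb R^n\to\mathbb R^n$ and $\ell:\mathbb R^n\to\mathbb R$ be $C^2$ with bounded second derivatives. A *mode schedule* $(\Sigma,\mathcal T)$ consists of modes $\Sigma=[\sigma_1,\dots,\sigma_M]$ with $\sigma_i\ne\sigma_{i+1}$ and switching times $0<T_1<\dots<T_{M-1}<T$; with $T_0=0$, $T_M=T$ its switching control is $u(t)=e_{\sigma_i}$ for $t\in[T_{i-1},T_i)$. Fix a schedule with control $u$ for which the state equation $\dot x=F(x,u):=\sum_i u_if_i(x)$, $x(0)=x_0$, has a solution $x$ on $[0,T]$. Let $J(x)=\int_0^T\ell(x)\,dt$, let $\rho$ be the continuous solution of $\dot\rho=-Df_{\sigma_i}(x)^T\rho-D\ell(x)^T$ on each $(T_{i-1},T_i)$ with $\rho(T)=0$, and let $d_a(t)=\rho(t)^T(f_a(x(t))-F(x(t),u(t)))$ be the mode insertion gradient. Write $d_{ab}=d_a-d_b$ and assume that for all $a\ne b$ it has finitely many critical points in $[0,T]$ (points where the derivative is zero or does not exist). Let $\theta=\inf_{a,\,t\in[0,T]}d_a(t)$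 and $\gamma_0=-1/\theta$. For $\mu:[0,T]\to\mathbb R^N$ let $Q_i(\mu)=\prod_{j\ne i}1(\mu_i-\mu_j\ge 0)$, and let $J(\gamma)$ be the cost of the trajectory, if it exists on $[0,T]$, with control $Q(u-\gamma d)$ and initial state $x_0$; $J(0)=J(x)$. Suppose $\theta<-b_1$ with $b_1>0$. Then for all $\gamma>\gamma_0$ close to $\gamma_0$ the control $Q(u-\gamma d)$ agrees almost everywhere with that of a mode schedule with a constant mode sequence, again written $[\sigma_1,\dots,\sigma_M]$, and switching times $T_1(\gamma)<\dots<T_{M-1}(\gamma)$. A superscript $+$ at $\gamma_0$ denotes the limit $\gamma\downarrow\gamma_0$. The time $T_i(\gamma_0^+)$ has type $0$ if $T_i(\gamma)$ is constant for $\gamma>\gamma_0$ near $\gamma_0$; otherwise its type is the least $m\ge1$ with $D^md_{\sigma_i\sigma_{i+1}}(T_i(\gamma_0^+))\ne0$. Let $\overline m$ be the greatest type, $I_2$ the set of indices of type $2$, and $\omega_i=0$ or $1$ according as $T_i(\gamma)>T_i(\gamma_0^+)$ or $T_i(\gamma)<T_i(\gamma_0^+)$ for $\gamma>\gamma_0$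 near $\gamma_0$. Assume $\overline m=2$ and that for some $b_2>0$ and every $i\in I_2$, $\ddot d_{\sigma_{i+\omega_i}}(T_i(\gamma))>b_2$ for all $\gamma>\gamma_0$ near $\gamma_0$. Let $\alpha,\beta\in(0,1)$ and $$s_2=-\sum_{i\in I_2}\frac{\sqrt2\,\theta^2}{\ddot d_{\sigma_{i+\omega_i}}(T_i(\gamma_0^+))^{1/2}},\qquad \gamma_3=\gamma_0\Bigl(2-\tfrac13\sqrt[3]{\alpha\tfrac{3\sqrt2}{2}}\Bigr),\qquad \gamma(j)=(\gamma_3-\gamma_0)\beta^j+\gamma_0 .$$ Say that $\gamma$ satisfies sufficient descent if $J(\gamma)$ is defined and $J(\gamma)-J(0)<\alpha s_2(\gamma-\gamma_0)^{1/2}$. Then the backtracking index $$j^*=\min\{j\in\{0,1,2,\dots\}:\gamma(j)\text{ satisfies sufficient descent}\}$$ exists, i.e. is finite. Moreover, there is $b_3\in(0,\gamma_3-\gamma_0]$ such that every $\gamma\in(\gamma_0,\gamma_0+b_3]$ satisfies sufficient descent, and for every such $b_3$ $$j^*\le\Bigl\lceil\log_\beta\frac{b_3}{\gamma_3-\gamma_0}\Bigr\rceil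 .$$ -/

import Mathlib

open Filter Topology MeasureTheory Set

noncomputable section

/-- The state space `ℝⁿ`, with its Euclidean structure. -/
abbrev State (n : ℕ) := EuclideanSpace ℝ (Fin n)

/-- An optimal mode scheduling problem with `N` modes on `[0,T]`: vector fields `f i`, running cost
`ℓ` and initial state `x₀`. The modes and the running cost are `C²` with bounded second
derivative. -/
structure SwitchedSystem (n N : ℕ) where
  T : ℝ
  T_pos : 0 < T
  f : Fin N → State n → State n
  ℓ : State n → ℝ
  x₀ : State n
  f_contDiff : ∀ i, ContDiff ℝ 2 (f i)
  f_bound : ∃ K₂ : ℝ, 0 < K₂ ∧ ∀ i x, ‖iteratedFDeriv ℝ 2 (f i) x‖ ≤ K₂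
  ℓ_contDiff : ContDiff ℝ 2 ℓ
  ℓ_bound : ∃ K₂ : ℝ, 0 < K₂ ∧ ∀ x, ‖iteratedFDeriv ℝ 2 ℓ x‖ ≤ K₂

/-- `(σ, τ)` is a mode schedule on `[0,T]`: `K` strictly increasing switching times in `(0,T)`, the
`i`-th of which separates the distinct modes `σ i.castSucc` (before) and `σ i.succ` (after). As
there are finitely many switching times, every mode dwells for at least some `δt > 0`, that is,
the schedule is non-chattering. -/
structure IsModeSchedule {N K : ℕ} (T : ℝ) (σ : Fin (K + 1) → Fin N) (τ : Fin K → ℝ) : Prop where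
  strictMono : StrictMono τ
  mem_Ioo : ∀ i, τ i ∈ Ioo 0 T
  mode_ne : ∀ i : Fin K, σ i.castSucc ≠ σ i.succ

/-- The number of switching times that are `≤ t`, which is the index of the mode active
at time `t`. -/
def activeIndex {K : ℕ} (τ : Fin K → ℝ) (t : ℝ) : Fin (K + 1) :=
  ⟨(Finset.univ.filter fun i => τ i ≤ t).card,
    Nat.lt_succ_of_le ((Finset.card_le_univ _).trans_eq (Fintype.card_fin K))⟩

/-- The switching control of a mode schedule: `u(t) = e_{σ_i}` for `t ∈ [T_{i-1}, T_i)`. -/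
def scheduleControl {N K : ℕ} (σ : Fin (K + 1) → Fin N) (τ : Fin K → ℝ) (t : ℝ) : Fin N → ℝ :=
  Pi.single (σ (activeIndex τ t)) 1

/-- `(σ, τ)` is the mode schedule of the control `u` on `[0,T]`. Equality is almost everywhere, as
a control may take other values at isolated times. -/
def IsScheduleOf {N K : ℕ} (T : ℝ) (σ : Fin (K + 1) → Fin N) (τ : Fin K → ℝ)
    (u : ℝ → Fin N → ℝ) : Prop :=
  IsModeSchedule T σ τ ∧ u =ᵐ[volume.restrict (Icc 0 T)] scheduleControl σ τ

/-- `u ∈ Ω`: `u` is a non-chattering switching control on `[0,T]`. That the components of `u` sum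
to one almost everywhere is part of the second clause. -/
def IsSwitchingControl {N : ℕ} (T : ℝ) (u : ℝ → Fin N → ℝ) : Prop :=
  (∀ t ∈ Icc 0 T, ∀ i, u t i = 0 ∨ u t i = 1) ∧
    ∃ (K : ℕ) (σ : Fin (K + 1) → Fin N) (τ : Fin K → ℝ), IsScheduleOf T σ τ u

/-- The step function. -/
def stepFn (r : ℝ) : ℝ := if 0 ≤ r then 1 else 0

/-- The max-mapping `Q`. -/
def maxMapping {N : ℕ} (μ : Fin N → ℝ) (i : Fin N) : ℝ :=
  ∏ j ∈ Finset.univ.erase i, stepFn (μ i - μ j)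

namespace SwitchedSystem

variable {n N : ℕ} (sys : SwitchedSystem n N)

/-- `F(x,u) = ∑ᵢ uᵢ fᵢ(x)`. -/
def F (x : State n) (u : Fin N → ℝ) : State n := ∑ i, u i • sys.f i x

/-- `(x,u) ∈ S`: `u` is a non-chattering switching control and `x` is the (continuous)
solution on `[0,T]` of `ẋ = F(x,u)`, `x(0) = x₀`. -/
def IsFeasible (x : ℝ → State n) (u : ℝ → Fin N → ℝ) : Prop :=
  IsSwitchingControl sys.T u ∧ ContinuousOn x (Icc 0 sys.T) ∧
    ∀ t ∈ Icc 0 sys.T, x t = sys.x₀ + ∫ s in (0 : ℝ)..t, sys.F (x s) (u s)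

/-- The cost `J(x,u) = ∫₀ᵀ ℓ(x)`. -/
def cost (x : ℝ → State n) : ℝ := ∫ s in (0 : ℝ)..sys.T, sys.ℓ (x s)

/-- `(x,u) = P(μ)`: the max-projection of the curve `μ`. -/
def IsMaxProjection (μ : ℝ → Fin N → ℝ) (x : ℝ → State n) (u : ℝ → Fin N → ℝ) : Prop :=
  (∀ t, u t = maxMapping (μ t)) ∧ sys.IsFeasible x u

end SwitchedSystem

/-- A feasible switched system trajectory `(x, Σ, 𝒯)` together with the solution `ρ` of its
adjoint equation. -/
structure Iterate {n N : ℕ} (sys : SwitchedSystem n N) where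
  K : ℕ
  σ : Fin (K + 1) → Fin N
  τ : Fin K → ℝ
  isModeSchedule : IsModeSchedule sys.T σ τ
  x : ℝ → State n
  feasible : sys.IsFeasible x (scheduleControl σ τ)
  ρ : ℝ → State n
  ρ_continuousOn : ContinuousOn ρ (Icc 0 sys.T)
  ρ_deriv : ∀ t ∈ Ioo 0 sys.T, t ∉ range τ →
    HasDerivAt ρ
      (-(ContinuousLinearMap.adjoint (fderiv ℝ (sys.f (σ (activeIndex τ t))) (x t)) (ρ t))
        - gradient sys.ℓ (x t)) t
  ρ_final : ρ sys.T = 0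

namespace Iterate

variable {n N : ℕ} {sys : SwitchedSystem n N} (z : Iterate sys)

/-- The switching control `u` of the iterate. -/
def u : ℝ → Fin N → ℝ := scheduleControl z.σ z.τ

/-- The mode insertion gradient `d_a(t) = ρ(t)ᵀ (f_a(x(t)) - F(x(t),u(t)))`. -/
def d (a : Fin N) (t : ℝ) : ℝ :=
  inner ℝ (z.ρ t) (sys.f a (z.x t) - sys.F (z.x t) (z.u t))

/-- The difference `d_{ab} = d_a - d_b`. -/
def dDiff (a b : Fin N) (t : ℝ) : ℝ := z.d a t - z.d b t

/-- For all `a ≠ b`, `d_{ab}` has finitely many critical points in `[0,T]`; a critical point is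
one where the derivative vanishes or does not exist. -/
def FinitelyManyCriticalPoints : Prop :=
  ∀ a b, a ≠ b →
    {t ∈ Icc 0 sys.T | ¬ DifferentiableAt ℝ (z.dDiff a b) t ∨ deriv (z.dDiff a b) t = 0}.Finite

/-- The optimality function `θ`, the greatest lower bound of all `d_a(t)`. -/
def θ : ℝ := sInf {r | ∃ a, ∃ t ∈ Icc 0 sys.T, r = z.d a t}

/-- `γ₀ = -1/θ`. -/
def γ₀ : ℝ := -1 / z.θ

/-- The curve `u - γ d`. -/
def μ (γ : ℝ) (t : ℝ) (a : Fin N) : ℝ := z.u t a - γ * z.d a t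

/-- The mode schedule `(Σ(γ), 𝒯(γ))` of `Q(u - γ d)` for all `γ > γ₀` near `γ₀`: a constant mode
sequence `σ` with switching times `τ γ`. -/
structure InitialSchedule where
  K : ℕ
  σ : Fin (K + 1) → Fin N
  τ : ℝ → Fin K → ℝ
  isScheduleOf : ∀ᶠ γ in 𝓝[>] z.γ₀, IsScheduleOf sys.T σ (τ γ) fun t => maxMapping (z.μ γ t)

namespace InitialSchedule

variable {z} (S : z.InitialSchedule)

/-- The switching time `T_i(γ)` does not vary with `γ > γ₀` near `γ₀`. -/
def Frozen (i : Fin S.K) : Prop := ∃ c, ∀ᶠ γ in 𝓝[>] z.γ₀, S.τ γ i = c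

/-- `Dˡ d_{σ_i σ_{i+1}}(T_i(γ₀⁺)) = v`. The superscript `⁺` is the limit from the right in `γ`, so
at a discontinuity of the derivative its value is taken on the side on which `T_i(γ)` lies. -/
def DerivAtPlus (i : Fin S.K) (l : ℕ) (v : ℝ) : Prop :=
  Tendsto (fun γ => iteratedDeriv l (z.dDiff (S.σ i.castSucc) (S.σ i.succ)) (S.τ γ i))
    (𝓝[>] z.γ₀) (𝓝 v)

/-- The switching time `T_i(γ₀⁺)` is of type `m`. -/
def HasType (i : Fin S.K) : ℕ → Prop
  | 0 => S.Frozen i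
  | m + 1 => ¬ S.Frozen i ∧ (∀ l, 1 ≤ l → l ≤ m → S.DerivAtPlus i l 0) ∧
      ∃ v, v ≠ 0 ∧ S.DerivAtPlus i (m + 1) v

/-- The greatest type of the switching times at `γ₀⁺` is `m`. -/
def GreatestType (m : ℕ) : Prop :=
  (∃ i, S.HasType i m) ∧ ∀ i, ∃ m' ≤ m, S.HasType i m'

/-- `ω_i = 0`: `T_i(γ) > T_i(γ₀⁺)` for `γ > γ₀` near `γ₀`. -/
def MovesRight (i : Fin S.K) : Prop :=
  ∃ c, Tendsto (fun γ => S.τ γ i) (𝓝[>] z.γ₀) (𝓝 c) ∧ ∀ᶠ γ in 𝓝[>] z.γ₀, c < S.τ γ i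

open Classical in
/-- The mode `σ_{i+ω_i}`: the mode before `T_i` if `ω_i = 0`, the mode after it if `ω_i = 1`. -/
def movingMode (i : Fin S.K) : Fin N :=
  if S.MovesRight i then S.σ i.castSucc else S.σ i.succ

/-- The second derivative of `d_{σ_{i+ω_i}}` at `T_i(γ)`. -/
def secondDeriv (i : Fin S.K) (γ : ℝ) : ℝ :=
  iteratedDeriv 2 (z.d (S.movingMode i)) (S.τ γ i)

open Classical in
/-- The set `I₂` of (indices of) type-2 switching times. -/
def I₂ : Finset (Fin S.K) := Finset.univ.filter fun i => S.HasType i 2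

/-- The constant `s₂` of the type-2 sufficient descent condition; the limit is the second
derivative of `d_{σ_{i+ω_i}}` at `T_i(γ₀⁺)`. -/
def s₂ : ℝ :=
  -∑ i ∈ S.I₂, √2 * z.θ ^ 2 / √(limUnder (𝓝[>] z.γ₀) (S.secondDeriv i))

/-- The step size `γ` satisfies the type-2 sufficient descent condition
`J(γ) - J(0) < α s₂ (γ - γ₀)^{1/2}`, where `J(γ)` is the cost of `P(u - γ d)`. If the state
equation for the control `Q(u - γ d)` has no solution on all of `[0,T]`, then `γ` fails the
condition. -/
def SufficientDescent (α γ : ℝ) : Prop :=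
  ∃ (x' : ℝ → State n) (u' : ℝ → Fin N → ℝ), sys.IsMaxProjection (z.μ γ) x' u' ∧
    sys.cost x' - sys.cost z.x < α * S.s₂ * √(γ - z.γ₀)

end InitialSchedule

/-- `γ₃ = γ₀ (2 - (α 3√2/2)^{1/3} / 3)`. -/
def γ₃ (α : ℝ) : ℝ := z.γ₀ * (2 - (α * (3 * √2 / 2)) ^ (1 / 3 : ℝ) / 3)

/-- The backtracking steps `γ(j) = (γ₃ - γ₀) βʲ + γ₀`. -/
def γStep (α β : ℝ) (j : ℕ) : ℝ := (z.γ₃ α - z.γ₀) * β ^ j + z.γ₀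

/-- The indices `j` of the backtracking steps that satisfy sufficient descent; backtracking returns
the least of them. -/
def InitialSchedule.acceptedSteps {z : Iterate sys} (S : z.InitialSchedule) (α β : ℝ) : Set ℕ :=
  {j | S.SufficientDescent α (z.γStep α β j)}

end Iterate

end

/-! Where the mode `s` is active, `u - γ d` has the entry `1` at `s` and `-γ d_k` at every other
`k`. So `Q` leaves `s` only where the least `d_a` is at most `-1/γ`, a level that decreases to `θ`
as `γ ↓ γ₀`. The critical points and zeros of all `d_{ab}`, together with the old switching times,
cut `[0,T]` into finitely many cells. In a cell the least mode `a` is fixed and `d_a = d_{as}` is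
strictly monotone. For `γ` near `γ₀` its sublevel set is therefore empty, or an interval attached to
the endpoint where `d_{as} = θ` (`IsCell.trichotomy`). Gluing cells gives the schedule, whose
switching times are fixed or leave a minimizer `c_i` along `d_{as} = -1/γ`; the displacements
`|T_i(γ) - c_i|` sum to at most `Δ(γ)`, the measure of the set where the control changes.

At type 2 the expansion `d_{as} ≈ θ + v (t - c)²/2` gives `|T_i(γ) - c_i| ~ √2 |θ| v^{-1/2} (γ -
γ₀)^{1/2}` (`level_right_asymptotics`, `level_left_asymptotics`).

By Grönwall the new trajectory exists for small `Δ` and stays within `O(Δ)` of the old one.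
Integrating the derivative of `ρᵀ(x' - x)`, which vanishes at both ends, gives `J(γ) - J(0) ≤ -Δ/γ +
CΔ²`, because a newly selected mode has `d_a ≤ -1/γ` (`exists_cost_sub_le`,
`exists_maxProjection_cost_le`). Since `1/γ₀ = -θ`, this bounds the upper limit of `(J(γ) - J(0)) /
(γ - γ₀)^{1/2}` by `s₂`, and `s₂ < α s₂` because `s₂ < 0`. Sufficient descent thus holds on some
`(γ₀, γ₀ + b₃]`, which the steps `γ(j)` reach. -/

noncomputable section

/-! ### Finite sets of reals. -/

/-- Induction along the consecutive elements of a finite set of reals. -/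
theorem consecutive_induction (B : Finset ℝ) (P : ℝ → Prop) (h0 : (0 : ℝ) ∈ B) (hP0 : P 0)
    (hstep : ∀ q q' : ℝ, 0 ≤ q → q ∈ B → q' ∈ B → q < q' → (∀ t ∈ Ioo q q', t ∉ B) → P q → P q') :
    ∀ q ∈ B, 0 ≤ q → P q := by
  classical
  by_contra! hne
  obtain ⟨r, hrB, hr0, hrP⟩ := hne
  obtain ⟨q', hq', hmin⟩ := (B.filter fun q => 0 ≤ q ∧ ¬ P q).exists_minimal
    ⟨r, by simp [hrB, hr0, hrP]⟩
  simp only [Finset.mem_filter] at hq' hmin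
  have hq'0 : 0 < q' := lt_of_le_of_ne hq'.2.1 fun h => hq'.2.2 (h ▸ hP0)
  obtain ⟨q, hq, hmax⟩ := (B.filter fun q => 0 ≤ q ∧ q < q').exists_maximal
    ⟨0, by simp [h0, hq'0]⟩
  simp only [Finset.mem_filter] at hq hmax
  refine hq'.2.2 (hstep q q' hq.2.1 hq.1 hq'.1 hq.2.2 (fun t ht htB => ?_) ?_)
  · exact absurd (hmax ⟨htB, hq.2.1.trans ht.1.le, ht.2⟩ ht.1.le) (not_le.2 ht.1)
  · by_contra hP
    exact absurd (hmin ⟨hq.1, hq.2.1, hP⟩ hq.2.2.le) (not_le.2 hq.2.2)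

/-- A set of reals whose points are pairwise separated by points of a finite set is finite. -/
theorem Set.Finite.of_separated {Z C : Set ℝ} (hC : C.Finite)
    (h : ∀ z ∈ Z, ∀ w ∈ Z, z < w → ∃ c ∈ C, c ∈ Ioo z w) : Z.Finite := by
  classical
  -- A point of `Z` is determined by which points of `C` lie below it, and `C` has finitely many
  -- subsets.
  have hinj : InjOn (fun z => (hC.toFinset.filter (· < z))) Z := by
    have key : ∀ z ∈ Z, ∀ w ∈ Z, z < w →
        hC.toFinset.filter (· < z) ≠ hC.toFinset.filter (· < w) := by
      intro z hz w hw hzw heq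
      obtain ⟨c, hc, hzc, hcw⟩ := h z hz w hw hzw
      have : c ∈ hC.toFinset.filter (· < z) := by
        rw [heq]; simp [hc, hcw]
      simp only [Finset.mem_filter] at this
      exact lt_asymm this.2 hzc
    intro z hz w hw hzw
    by_contra hne
    rcases lt_or_gt_of_ne hne with hlt | hlt
    · exact key z hz w hw hlt hzw
    · exact key w hw z hz hlt hzw.symm
  refine Set.Finite.of_finite_image (Set.Finite.subset (hC.toFinset.powerset.finite_toSet) ?_) hinj
  rintro _ ⟨z, -, rfl⟩
  simp

/-! ### Level functions at the height `-1/γ` and their square root asymptotics. -/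

theorem tendsto_neg_one_div_nhdsGT {θ : ℝ} (hθ : θ < 0) :
    Tendsto (fun x : ℝ => -1 / x) (𝓝[>] θ) (𝓝[>] (-1 / θ)) := by
  refine tendsto_nhdsWithin_iff.2 ⟨?_, ?_⟩
  · exact (continuousAt_const.div continuousAt_id hθ.ne).tendsto.mono_left nhdsWithin_le_nhds
  · filter_upwards [self_mem_nhdsWithin, mem_nhdsWithin_of_mem_nhds (Iio_mem_nhds hθ)] with x hx hx0
    simp only [mem_Ioi, mem_Iio] at *
    rw [← sub_pos, show -1 / x - -1 / θ = (x - θ) / (x * θ) by field_simp [hx0.ne, hθ.ne]; ring]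
    exact div_pos (sub_pos.2 hx) (mul_pos_of_neg_of_neg hx0 hθ)

theorem tendsto_neg_one_div_nhdsGT' {θ : ℝ} (hθ : θ < 0) :
    Tendsto (fun x : ℝ => -1 / x) (𝓝[>] (-1 / θ)) (𝓝[>] θ) := by
  have hp : 0 < -1 / θ := div_pos_of_neg_of_neg (by norm_num) hθ
  have h2 : -1 / (-1 / θ) = θ := by field_simp
  refine tendsto_nhdsWithin_iff.2 ⟨?_, ?_⟩
  · have h4 : Tendsto (fun x : ℝ => -1 / x) (𝓝 (-1 / θ)) (𝓝 (-1 / (-1 / θ))) :=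
      tendsto_const_nhds.div tendsto_id hp.ne'
    rw [h2] at h4
    exact h4.mono_left nhdsWithin_le_nhds
  · filter_upwards [self_mem_nhdsWithin] with x hx
    simp only [mem_Ioi] at *
    have hx0 := hp.trans hx
    rw [div_lt_iff_of_neg hθ] at hx
    rw [lt_div_iff₀ hx0]
    linarith

/-- The level function of a strictly increasing function at the left end of an interval. -/
theorem exists_level_right {G : ℝ → ℝ} {q q' θ : ℝ} (hθ : θ < 0) (hq : q < q')
    (hG : ContinuousOn G (Icc q q')) (hmono : StrictMonoOn G (Icc q q')) (hGq : G q = θ) :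
    ∃ h : ℝ → ℝ, (∀ᶠ γ in 𝓝[>] (-1 / θ), h γ ∈ Ioo q q' ∧ G (h γ) = -1 / γ) ∧
      Tendsto h (𝓝[>] (-1 / θ)) (𝓝 q) := by
  have hex : ∀ r, ∃ t, r ∈ Ioo θ (G q') → t ∈ Ioo q q' ∧ G t = r := by
    intro r
    by_cases hr : r ∈ Ioo θ (G q')
    · obtain ⟨t, ht, h⟩ := intermediate_value_Ioo hq.le hG (by rwa [hGq])
      exact ⟨t, fun _ => ⟨ht, h⟩⟩
    · exact ⟨0, fun h => absurd h hr⟩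
  choose k hk using hex
  have hGq' : θ < G q' := hGq ▸ hmono ⟨le_rfl, hq.le⟩ ⟨hq.le, le_rfl⟩ hq
  have hev : ∀ᶠ r in 𝓝[>] θ, k r ∈ Ioo q q' ∧ G (k r) = r := by
    filter_upwards [Ioo_mem_nhdsGT hGq'] with r hr using hk r hr
  have hlim : Tendsto k (𝓝[>] θ) (𝓝 q) := by
    refine tendsto_order.2 ⟨fun a ha => ?_, fun a ha => ?_⟩
    · filter_upwards [hev] with r hr using ha.trans hr.1.1
    · obtain ⟨u, hu1, hu2⟩ := exists_between (lt_min hq ha)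
      have hu : u ∈ Icc q q' := ⟨hu1.le, hu2.le.trans (min_le_left _ _)⟩
      have hGu : θ < G u := hGq ▸ hmono ⟨le_rfl, hq.le⟩ hu hu1
      filter_upwards [hev, Ioo_mem_nhdsGT hGu] with r hr hr'
      have : k r < u := by
        rw [← hmono.lt_iff_lt ⟨hr.1.1.le, hr.1.2.le⟩ hu, hr.2]
        exact hr'.2
      exact this.trans (hu2.trans_le (min_le_right _ _))
  exact ⟨fun γ => k (-1 / γ), (tendsto_neg_one_div_nhdsGT' hθ).eventually hev,
    hlim.comp (tendsto_neg_one_div_nhdsGT' hθ)⟩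

/-- If `G` has the expansion `θ + v (t - q)² / 2` along its level function `h`, then `h` moves
away from `q` at the rate of a square root. -/
theorem level_right_asymptotics {G h : ℝ → ℝ} {q q' θ v : ℝ} (hθ : θ < 0) (hq : q < q')
    (hG : ContinuousOn G (Icc q q')) (hmono : StrictMonoOn G (Icc q q')) (hGq : G q = θ)
    (hdiff : ∀ t ∈ Ioo q q', DifferentiableAt ℝ G t)
    (hh : ∀ᶠ γ in 𝓝[>] (-1 / θ), h γ ∈ Ioo q q' ∧ G (h γ) = -1 / γ)
    (hlim : Tendsto h (𝓝[>] (-1 / θ)) (𝓝 q)) (hv : 0 < v)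
    (h1 : Tendsto (fun γ => deriv G (h γ)) (𝓝[>] (-1 / θ)) (𝓝 0))
    (h2 : Tendsto (fun γ => deriv (deriv G) (h γ)) (𝓝[>] (-1 / θ)) (𝓝 v)) :
    Tendsto (fun γ => |h γ - q| / √(γ - (-1 / θ))) (𝓝[>] (-1 / θ)) (𝓝 (√2 * |θ| / √v)) := by
  have hp : 0 < -1 / θ := div_pos_of_neg_of_neg (by norm_num) hθ
  have hGlim : Tendsto G (𝓝[>] q) (𝓝 θ) := by
    have := (hG q ⟨le_rfl, hq.le⟩).tendsto
    rw [hGq] at this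
    exact this.mono_left (by
      rw [← nhdsWithin_Ioo_eq_nhdsGT hq]; exact nhdsWithin_mono _ Ioo_subset_Icc_self)
  have hGlim' : Tendsto G (𝓝[>] q) (𝓝[>] θ) := by
    refine tendsto_nhdsWithin_iff.2 ⟨hGlim, ?_⟩
    filter_upwards [Ioo_mem_nhdsGT hq] with t ht
    exact hGq ▸ hmono ⟨le_rfl, hq.le⟩ ⟨ht.1.le, ht.2.le⟩ ht.1
  have hback : Tendsto (fun t => -1 / G t) (𝓝[>] q) (𝓝[>] (-1 / θ)) :=
    (tendsto_neg_one_div_nhdsGT hθ).comp hGlim'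
  have hinv : ∀ᶠ t in 𝓝[>] q, h (-1 / G t) = t := by
    filter_upwards [hback.eventually hh, Ioo_mem_nhdsGT hq,
      hGlim.eventually (Iio_mem_nhds hθ)] with t ht ht' hneg
    refine hmono.injOn ⟨ht.1.1.le, ht.1.2.le⟩ ⟨ht'.1.le, ht'.2.le⟩ ?_
    rw [ht.2]
    have : G t ≠ 0 := ne_of_lt hneg
    field_simp
  -- The derivative limits are known only along `h`. Near `q` the map `t ↦ -1 / G t` is a right
  -- inverse of `h`, which turns them into limits as `t ↓ q`. L'Hôpital's rule then applies twice.
  have transfer : ∀ (F : ℝ → ℝ) (l : ℝ), Tendsto (fun γ => F (h γ)) (𝓝[>] (-1 / θ)) (𝓝 l) →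
      Tendsto F (𝓝[>] q) (𝓝 l) := by
    intro F l hF
    refine (hF.comp hback).congr' ?_
    filter_upwards [hinv] with t ht
    simp [ht]
  have h1' := transfer _ _ h1
  have h2' := transfer _ _ h2
  have hsub : Tendsto (fun t : ℝ => t - q) (𝓝[>] q) (𝓝 0) := by
    have : Tendsto (fun t : ℝ => t - q) (𝓝 q) (𝓝 (q - q)) := tendsto_id.sub_const q
    rw [sub_self] at this
    exact this.mono_left nhdsWithin_le_nhds
  have hder1 : Tendsto (fun t => deriv G t / (t - q)) (𝓝[>] q) (𝓝 v) := by
    refine deriv.lhopital_zero_nhdsGT ?_ ?_ h1' hsub ?_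
    -- `deriv` is zero at points of non-differentiability, so a positive value of `deriv (deriv G)`
    -- certifies that `deriv G` is differentiable there.
    · filter_upwards [h2'.eventually (Ioi_mem_nhds hv)] with t ht
      by_contra hnd
      rw [deriv_zero_of_not_differentiableAt hnd] at ht
      exact lt_irrefl _ ht
    · exact Eventually.of_forall fun t => by simp
    · simp only [deriv_sub_const, deriv_id'', div_one]
      exact h2'
  have hsq : ∀ t, deriv (fun t : ℝ => (t - q) ^ 2) t = 2 * (t - q) := by
    intro t
    simp
  have hder0 : Tendsto (fun t => (G t - θ) / (t - q) ^ 2) (𝓝[>] q) (𝓝 (v / 2)) := by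
    refine deriv.lhopital_zero_nhdsGT ?_ ?_ ?_ ?_ ?_
    · filter_upwards [Ioo_mem_nhdsGT hq] with t ht using (hdiff t ht).sub_const θ
    · filter_upwards [self_mem_nhdsWithin] with t ht
      rw [hsq]
      have : 0 < t - q := sub_pos.2 ht
      positivity
    · rw [← sub_self θ]
      exact hGlim.sub_const θ
    · simpa using hsub.pow 2
    · refine (hder1.div_const 2).congr' ?_
      filter_upwards with t
      rw [hsq, deriv_sub_const, div_div, mul_comm]
  have hh' : Tendsto h (𝓝[>] (-1 / θ)) (𝓝[>] q) :=
    tendsto_nhdsWithin_iff.2 ⟨hlim, hh.mono fun γ hγ => hγ.1.1⟩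
  have hγlim : Tendsto (fun γ : ℝ => γ * (-1 / θ)) (𝓝[>] (-1 / θ)) (𝓝 ((-1 / θ) * (-1 / θ))) :=
    (tendsto_id.mul_const _).mono_left nhdsWithin_le_nhds
  have hprod := (hγlim.mul (hder0.comp hh')).sqrt.inv₀ (by positivity)
  have hval : (√((-1 / θ) * (-1 / θ) * (v / 2)))⁻¹ = √2 * |θ| / √v := by
    rw [Real.sqrt_mul (by positivity), Real.sqrt_mul_self hp.le, Real.sqrt_div hv.le, abs_of_neg hθ]
    have : √v ≠ 0 := (Real.sqrt_pos.2 hv).ne'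
    field_simp
  rw [hval] at hprod
  refine hprod.congr' ?_
  filter_upwards [hh, self_mem_nhdsWithin] with γ hγ hγ0
  simp only [mem_Ioi] at hγ0
  have hγp : 0 < γ := hp.trans hγ0
  have hd : 0 < h γ - q := sub_pos.2 hγ.1.1
  -- As `G (h γ) = -1/γ`, the identity `γ (-1/θ) (G (h γ) - θ) = γ - γ₀` is exact, with `γ₀ = -1/θ`.
  have : γ * (-1 / θ) * ((G (h γ) - θ) / (h γ - q) ^ 2) = (γ - (-1 / θ)) / (h γ - q) ^ 2 := by
    rw [hγ.2]
    have := hθ.ne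
    field_simp
    ring
  simp only [Function.comp]
  rw [this, Real.sqrt_div (sub_pos.2 hγ0).le, Real.sqrt_sq hd.le, inv_div, abs_of_pos hd]

/-- The level function of a strictly decreasing function at the right end of an interval. -/
theorem exists_level_left {G : ℝ → ℝ} {q q' θ : ℝ} (hθ : θ < 0) (hq : q < q')
    (hG : ContinuousOn G (Icc q q')) (hmono : StrictAntiOn G (Icc q q')) (hGq : G q' = θ) :
    ∃ h : ℝ → ℝ, (∀ᶠ γ in 𝓝[>] (-1 / θ), h γ ∈ Ioo q q' ∧ G (h γ) = -1 / γ) ∧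
      Tendsto h (𝓝[>] (-1 / θ)) (𝓝 q') := by
  have hmaps : MapsTo (fun t : ℝ => -t) (Icc (-q') (-q)) (Icc q q') := fun t ht =>
    ⟨by linarith [ht.2], by linarith [ht.1]⟩
  obtain ⟨h, h1, h2⟩ := exists_level_right (G := fun t => G (-t)) (q := -q') (q' := -q) hθ
    (by linarith) (hG.comp continuousOn_neg hmaps)
    (fun s hs t ht hst => hmono (hmaps ht) (hmaps hs) (by linarith)) (by simpa)
  refine ⟨fun γ => -h γ, ?_, by simpa using h2.neg⟩
  filter_upwards [h1] with γ hγ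
  exact ⟨⟨by linarith [hγ.1.2], by linarith [hγ.1.1]⟩, hγ.2⟩

/-- Time reversal reduces this to the right end case: the first derivative changes sign, which its
limit `0` does not notice, and the second is unchanged. -/
theorem level_left_asymptotics {G h : ℝ → ℝ} {q q' θ v : ℝ} (hθ : θ < 0) (hq : q < q')
    (hG : ContinuousOn G (Icc q q')) (hmono : StrictAntiOn G (Icc q q')) (hGq : G q' = θ)
    (hdiff : ∀ t ∈ Ioo q q', DifferentiableAt ℝ G t)
    (hh : ∀ᶠ γ in 𝓝[>] (-1 / θ), h γ ∈ Ioo q q' ∧ G (h γ) = -1 / γ)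
    (hlim : Tendsto h (𝓝[>] (-1 / θ)) (𝓝 q')) (hv : 0 < v)
    (h1 : Tendsto (fun γ => deriv G (h γ)) (𝓝[>] (-1 / θ)) (𝓝 0))
    (h2 : Tendsto (fun γ => deriv (deriv G) (h γ)) (𝓝[>] (-1 / θ)) (𝓝 v)) :
    Tendsto (fun γ => |h γ - q'| / √(γ - (-1 / θ))) (𝓝[>] (-1 / θ)) (𝓝 (√2 * |θ| / √v)) := by
  have hmaps : MapsTo (fun t : ℝ => -t) (Icc (-q') (-q)) (Icc q q') := fun t ht =>
    ⟨by linarith [ht.2], by linarith [ht.1]⟩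
  have hd1 : deriv (fun t => G (-t)) = fun t => -deriv G (-t) := funext fun t => deriv_comp_neg G t
  have hd2 : deriv (fun t => -deriv G (-t)) = fun t => deriv (deriv G) (-t) := by
    funext t
    rw [deriv.fun_neg, deriv_comp_neg (deriv G) t, neg_neg]
  have := level_right_asymptotics (G := fun t => G (-t)) (h := fun γ => -h γ)
    (q := -q') (q' := -q) (v := v) hθ
    (by linarith) (hG.comp continuousOn_neg hmaps)
    (fun s hs t ht hst => hmono (hmaps ht) (hmaps hs) (by linarith)) (by simpa)
    (fun t ht => (hdiff (-t) ⟨by linarith [ht.2], by linarith [ht.1]⟩).comp t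
      differentiableAt_id.neg)
    (by
      filter_upwards [hh] with γ hγ
      exact ⟨⟨by linarith [hγ.1.2], by linarith [hγ.1.1]⟩, by simpa using hγ.2⟩)
    hlim.neg hv (by simpa [hd1] using h1.neg) (by simpa [hd1, hd2] using h2)
  refine this.congr fun γ => ?_
  rw [← abs_neg]; ring_nf

/-! ### Grönwall's inequality and bounded Lipschitz vector fields. -/

/-- Grönwall's inequality in integral form. -/
theorem le_mul_exp_of_le_add_integral {φ : ℝ → ℝ} {T δ Λ : ℝ} (hΛ : 0 ≤ Λ)
    (hφ : ContinuousOn φ (Icc 0 T))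
    (h : ∀ t ∈ Icc 0 T, φ t ≤ δ + Λ * ∫ s in (0 : ℝ)..t, φ s) :
    ∀ t ∈ Icc 0 T, φ t ≤ δ * Real.exp (Λ * t) := by
  intro t ht
  have hT : 0 ≤ T := ht.1.trans ht.2
  -- `φ` need not be differentiable, so the differential inequality is applied to its majorant.
  set Φ : ℝ → ℝ := fun t => δ + Λ * ∫ s in (0 : ℝ)..t, φ s with hΦ
  have hcont : ContinuousOn Φ (Icc 0 T) := by
    have := intervalIntegral.continuousOn_primitive_interval (a := 0) (b := T) (μ := volume) (f := φ)
      (by rw [uIcc_of_le hT]; exact hφ.integrableOn_Icc)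
    rw [uIcc_of_le hT] at this
    exact continuousOn_const.add (continuousOn_const.mul this)
  have hder : ∀ x ∈ Ico 0 T, HasDerivWithinAt Φ (Λ * φ x) (Ici x) x := by
    intro x hx
    have hmem : Icc x T ∈ 𝓝[>] x := mem_of_superset (Ioo_mem_nhdsGT hx.2) Ioo_subset_Icc_self
    have hsub : Icc x T ⊆ Icc 0 T := Icc_subset_Icc_left hx.1
    have hmeas : StronglyMeasurableAtFilter φ (𝓝[>] x) := by
      exact ⟨Icc x T, hmem, ((hφ.mono hsub).integrableOn_Icc).aestronglyMeasurable⟩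
    have hc : ContinuousWithinAt φ (Ioi x) x :=
      (((hφ.mono hsub) x ⟨le_rfl, hx.2.le⟩).mono_of_mem_nhdsWithin hmem)
    have hint : IntervalIntegrable φ volume 0 x :=
      (hφ.mono (by rw [uIcc_of_le hx.1]; exact Icc_subset_Icc_right hx.2.le)).intervalIntegrable
    exact ((intervalIntegral.integral_hasDerivWithinAt_right hint hmeas hc).const_mul Λ).const_add δ
  have := le_gronwallBound_of_liminf_deriv_right_le (f := Φ) (f' := fun x => Λ * φ x) (δ := δ)
    (K := Λ) (ε := 0) hcont (fun x hx r hr => (hder x hx).liminf_right_slope_le hr)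
    (by simp [hΦ]) (fun x hx => by
      have := mul_le_mul_of_nonneg_left (h x ⟨hx.1, hx.2.le⟩) hΛ
      simpa [hΦ] using this) t ht
  rw [gronwallBound_ε0, sub_zero] at this
  exact (h t ht).trans this

/-- A bounded Lipschitz vector field has solutions on arbitrary intervals. -/
theorem exists_solution_of_lipschitz_of_bounded {E : Type*} [NormedAddCommGroup E]
    [NormedSpace ℝ E] [CompleteSpace E] {G : E → E} {Λ : NNReal} {M : ℝ}
    (hG : LipschitzWith Λ G) (hM : ∀ x, ‖G x‖ ≤ M) {a b : ℝ} (hab : a ≤ b) (y₀ : E) :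
    ∃ w : ℝ → E, w a = y₀ ∧ ∀ t ∈ Icc a b, HasDerivWithinAt w (G (w t)) (Icc a b) t := by
  have hM0 : 0 ≤ M := (norm_nonneg _).trans (hM y₀)
  -- With speed at most `M`, no solution leaves the ball of radius `M (b - a)`, so one Picard step
  -- covers the whole interval.
  have hPL : IsPicardLindelof (fun _ : ℝ => G) (tmin := a) (tmax := b) ⟨a, le_rfl, hab⟩ y₀
      (M.toNNReal * (b - a).toNNReal) 0 M.toNNReal Λ :=
    { lipschitzOnWith := fun t _ => hG.lipschitzOnWith
      continuousOn := fun x _ => continuousOn_const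
      norm_le := fun t _ x _ => by rw [Real.coe_toNNReal _ hM0]; exact hM x
      mul_max_le := by
        simp [Real.coe_toNNReal _ hM0, hab] }
  exact hPL.exists_eq_forall_mem_Icc_hasDerivWithinAt₀

/-! ### Active modes and the uniqueness of the schedule of a control. -/

section ActiveIndex

variable {K : ℕ} {τ : Fin K → ℝ}

theorem activeIndex_val (τ : Fin K → ℝ) (t : ℝ) :
    (activeIndex τ t : ℕ) = (Finset.univ.filter fun i => τ i ≤ t).card := rfl

theorem activeIndex_congr {s t : ℝ} (h : ∀ j, τ j ≤ s ↔ τ j ≤ t) :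
    activeIndex τ s = activeIndex τ t := by
  apply Fin.ext
  simp only [activeIndex_val, h]

theorem activeIndex_eq_castSucc {i : Fin K} {t : ℝ} (h : ∀ j, τ j ≤ t ↔ j < i) :
    activeIndex τ t = i.castSucc := by
  apply Fin.ext
  have : (Finset.univ.filter fun j => j < i) = Finset.Iio i := by ext; simp
  simp only [activeIndex_val, h, this]
  simp

theorem activeIndex_eq_succ {i : Fin K} {t : ℝ} (h : ∀ j, τ j ≤ t ↔ j ≤ i) :
    activeIndex τ t = i.succ := by
  apply Fin.ext
  have : (Finset.univ.filter fun j => j ≤ i) = Finset.Iic i := by ext; simp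
  simp only [activeIndex_val, h, this]
  simp

theorem eventually_activeIndex_left (hτ : StrictMono τ) (i : Fin K) :
    ∀ᶠ t in 𝓝[<] τ i, activeIndex τ t = i.castSucc := by
  have : ∀ᶠ t in 𝓝[<] τ i, ∀ j, j < i → τ j ≤ t := by
    refine eventually_all.2 fun j => ?_
    by_cases hj : j < i
    · filter_upwards [Ioo_mem_nhdsLT (hτ hj)] with t ht _ using ht.1.le
    · exact Eventually.of_forall fun t h => absurd h hj
  filter_upwards [this, self_mem_nhdsWithin] with t ht ht'
  refine activeIndex_eq_castSucc fun j => ⟨fun h => ?_, ht j⟩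
  exact hτ.lt_iff_lt.1 (h.trans_lt ht')

theorem eventually_activeIndex_right (hτ : StrictMono τ) (i : Fin K) :
    ∀ᶠ t in 𝓝[>] τ i, activeIndex τ t = i.succ := by
  have : ∀ᶠ t in 𝓝[>] τ i, ∀ j, i < j → t < τ j := by
    refine eventually_all.2 fun j => ?_
    by_cases hj : i < j
    · filter_upwards [Ioo_mem_nhdsGT (hτ hj)] with t ht _ using ht.2
    · exact Eventually.of_forall fun t h => absurd h hj
  filter_upwards [this, self_mem_nhdsWithin] with t ht ht'
  refine activeIndex_eq_succ fun j => ⟨fun h => ?_, fun h => ?_⟩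
  · by_contra hj
    exact absurd (ht j (not_le.1 hj)) (not_lt.2 h)
  · exact (hτ.monotone h).trans (le_of_lt ht')

theorem eventually_activeIndex_eq {t : ℝ} (ht : t ∉ range τ) :
    ∀ᶠ s in 𝓝 t, activeIndex τ s = activeIndex τ t := by
  have : ∀ᶠ s in 𝓝 t, ∀ j, (τ j ≤ s ↔ τ j ≤ t) := by
    refine eventually_all.2 fun j => ?_
    rcases lt_or_gt_of_ne (fun h => ht ⟨j, h⟩ : τ j ≠ t) with hj | hj
    · filter_upwards [Ioi_mem_nhds hj] with s hs
      exact ⟨fun _ => hj.le, fun _ => le_of_lt hs⟩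
    · filter_upwards [Iio_mem_nhds hj] with s hs
      exact ⟨fun h => absurd hs (not_lt.2 h), fun h => absurd hj (not_lt.2 h)⟩
  exact this.mono fun s hs => activeIndex_congr hs

theorem measurable_activeIndex (τ : Fin K → ℝ) : Measurable (activeIndex τ) := by
  have hmono : Monotone fun t => (activeIndex τ t : ℕ) := by
    intro s t hst
    simp only [activeIndex_val]
    refine Finset.card_le_card fun j hj => ?_
    simp only [Finset.mem_filter] at *
    exact ⟨hj.1, hj.2.trans hst⟩
  refine measurable_to_countable' fun k => ?_
  have : activeIndex τ ⁻¹' {k} = (fun t => (activeIndex τ t : ℕ)) ⁻¹' {(k : ℕ)} := by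
    ext t; simp [Fin.ext_iff]
  rw [this]
  exact hmono.measurable (measurableSet_singleton _)

theorem activeIndex_snoc_of_lt {p : Fin K → ℝ} {g t : ℝ} (ht : t < g) :
    activeIndex (Fin.snoc p g : Fin (K + 1) → ℝ) t = (activeIndex p t).castSucc := by
  apply Fin.ext
  simp only [activeIndex_val, Fin.val_castSucc, Finset.card_filter, Fin.sum_univ_castSucc,
    Fin.snoc_castSucc, Fin.snoc_last, not_le.2 ht]
  simp

theorem activeIndex_eq_last {p : Fin K → ℝ} {t : ℝ} (ht : ∀ i, p i ≤ t) :
    activeIndex p t = Fin.last K := by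
  apply Fin.ext
  simp [activeIndex_val, ht]

end ActiveIndex

theorem scheduleControl_injective_mode {N K K' : ℕ} {σ : Fin (K + 1) → Fin N} {τ : Fin K → ℝ}
    {σ' : Fin (K' + 1) → Fin N} {τ' : Fin K' → ℝ} {t : ℝ}
    (h : scheduleControl σ τ t = scheduleControl σ' τ' t) :
    σ (activeIndex τ t) = σ' (activeIndex τ' t) := by
  have := congrFun h (σ (activeIndex τ t))
  by_contra hne
  simp [scheduleControl, hne] at this

/-- A one-sided neighbourhood contains an interval of positive length. This lets almost everywhere
equalities of controls be read off just beside a switching time. -/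
theorem exists_of_ae_of_eventually_left {x : ℝ} {p P : ℝ → Prop} (hp : ∀ᵐ t, p t)
    (hP : ∀ᶠ t in 𝓝[<] x, P t) : ∃ t, p t ∧ P t := by
  obtain ⟨l, hl, hsub⟩ := (mem_nhdsLT_iff_exists_Ioo_subset).1 hP
  by_contra! hne
  have h0 : volume (Ioo l x) = 0 :=
    measure_mono_null (fun t ht hpt => hne t hpt (hsub ht)) hp
  rw [Real.volume_Ioo, ENNReal.ofReal_eq_zero] at h0
  linarith [show l < x from hl]

theorem exists_of_ae_of_eventually_right {x : ℝ} {p P : ℝ → Prop} (hp : ∀ᵐ t, p t)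
    (hP : ∀ᶠ t in 𝓝[>] x, P t) : ∃ t, p t ∧ P t := by
  obtain ⟨l, hl, hsub⟩ := (mem_nhdsGT_iff_exists_Ioo_subset).1 hP
  by_contra! hne
  have h0 : volume (Ioo x l) = 0 :=
    measure_mono_null (fun t ht hpt => hne t hpt (hsub ht)) hp
  rw [Real.volume_Ioo, ENNReal.ofReal_eq_zero] at h0
  linarith [show x < l from hl]

section Uniqueness

variable {N K K' : ℕ} {T : ℝ} {σ : Fin (K + 1) → Fin N} {τ : Fin K → ℝ}
  {σ' : Fin (K' + 1) → Fin N} {τ' : Fin K' → ℝ}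

/-- At a time outside `range τ'` the second schedule has the same mode on both sides, while the
first changes its mode across every `τ i`. -/
theorem IsModeSchedule.range_subset (hs : IsModeSchedule T σ τ)
    (h : ∀ᵐ t, t ∈ Ioo 0 T → scheduleControl σ τ t = scheduleControl σ' τ' t) :
    range τ ⊆ range τ' := by
  rintro _ ⟨i, rfl⟩
  by_contra hi
  have hev := eventually_activeIndex_eq hi
  have hT := Ioo_mem_nhds (hs.mem_Ioo i).1 (hs.mem_Ioo i).2
  obtain ⟨s, hs1, hs2, hs3, hs4⟩ := exists_of_ae_of_eventually_left h
    ((eventually_activeIndex_left hs.strictMono i).and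
      ((hev.filter_mono nhdsWithin_le_nhds).and (nhdsWithin_le_nhds hT)))
  obtain ⟨r, hr1, hr2, hr3, hr4⟩ := exists_of_ae_of_eventually_right h
    ((eventually_activeIndex_right hs.strictMono i).and
      ((hev.filter_mono nhdsWithin_le_nhds).and (nhdsWithin_le_nhds hT)))
  have e1 := scheduleControl_injective_mode (hs1 hs4)
  have e2 := scheduleControl_injective_mode (hr1 hr4)
  rw [hs2, hs3] at e1
  rw [hr2, hr3] at e2
  exact hs.mode_ne i (e1.trans e2.symm)

theorem IsModeSchedule.card_eq (hs : IsModeSchedule T σ τ) (hs' : IsModeSchedule T σ' τ')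
    (h : ∀ᵐ t, t ∈ Ioo 0 T → scheduleControl σ τ t = scheduleControl σ' τ' t) : K = K' := by
  have hr : range τ = range τ' := (hs.range_subset h).antisymm
    (hs'.range_subset (h.mono fun t ht hT => (ht hT).symm))
  have h1 := Set.ncard_image_of_injective univ hs.strictMono.injective
  have h2 := Set.ncard_image_of_injective univ hs'.strictMono.injective
  rw [image_univ, hr, ← image_univ, h2] at h1
  simpa [Set.ncard_univ] using h1.symm

theorem IsModeSchedule.times_eq {σ' : Fin (K + 1) → Fin N} {τ' : Fin K → ℝ}
    (hs : IsModeSchedule T σ τ) (hs' : IsModeSchedule T σ' τ')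
    (h : ∀ᵐ t, t ∈ Ioo 0 T → scheduleControl σ τ t = scheduleControl σ' τ' t) : τ = τ' := by
  have hr : range τ = range τ' := (hs.range_subset h).antisymm
    (hs'.range_subset (h.mono fun t ht hT => (ht hT).symm))
  exact (hs.strictMono.range_inj hs'.strictMono).1 hr

theorem IsModeSchedule.modes_eq {σ' : Fin (K + 1) → Fin N}
    (hs : IsModeSchedule T σ τ)
    (h : ∀ᵐ t, t ∈ Ioo 0 T → scheduleControl σ τ t = scheduleControl σ' τ t) (i : Fin K) :
    σ i.castSucc = σ' i.castSucc ∧ σ i.succ = σ' i.succ := by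
  have hT := Ioo_mem_nhds (hs.mem_Ioo i).1 (hs.mem_Ioo i).2
  obtain ⟨s, hs1, hs2, hs4⟩ := exists_of_ae_of_eventually_left h
    ((eventually_activeIndex_left hs.strictMono i).and (nhdsWithin_le_nhds hT))
  obtain ⟨r, hr1, hr2, hr4⟩ := exists_of_ae_of_eventually_right h
    ((eventually_activeIndex_right hs.strictMono i).and (nhdsWithin_le_nhds hT))
  have e1 := scheduleControl_injective_mode (hs1 hs4)
  have e2 := scheduleControl_injective_mode (hr1 hr4)
  rw [hs2] at e1
  rw [hr2] at e2
  exact ⟨e1, e2⟩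

end Uniqueness

/-! ### Switched integrands and the max-mapping. -/

/-- Switching measurably between finitely many continuous functions gives an integrable one. -/
theorem integrableOn_switched {ι E : Type*} [Fintype ι] [DecidableEq ι] [MeasurableSpace ι]
    [MeasurableSingletonClass ι] [NormedAddCommGroup E] {A : ℝ → ι}
    (hA : Measurable A) {a b : ℝ} {g : ι → ℝ → E} (hg : ∀ i, ContinuousOn (g i) (Icc a b)) :
    IntegrableOn (fun s => g (A s) s) (Icc a b) := by
  have : (fun s => g (A s) s) = fun s => ∑ i, indicator (A ⁻¹' {i}) (g i) s := by
    funext s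
    rw [Finset.sum_eq_single (A s)]
    · simp
    · intro i _ hi
      simp [indicator, hi.symm]
    · simp
  rw [this]
  exact integrable_finsetSum _ fun i _ =>
    ((hg i).integrableOn_Icc).indicator (hA (measurableSet_singleton i))

theorem maxMapping_eq_single {N : ℕ} {μ : Fin N → ℝ} {i : Fin N} (h : ∀ j, j ≠ i → μ j < μ i) :
    maxMapping μ = Pi.single i 1 := by
  funext k
  unfold maxMapping
  by_cases hk : k = i
  · subst hk
    rw [Pi.single_eq_same]
    refine Finset.prod_eq_one fun j hj => ?_
    rw [stepFn, if_pos (sub_nonneg.2 (h j (Finset.ne_of_mem_erase hj)).le)]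
  · rw [Pi.single_eq_of_ne hk]
    refine Finset.prod_eq_zero (Finset.mem_erase.2 ⟨Ne.symm hk, Finset.mem_univ i⟩) ?_
    rw [stepFn, if_neg (not_le.2 (sub_neg.2 (h k hk)))]

theorem maxMapping_eq_zero_or_one {N : ℕ} (μ : Fin N → ℝ) (i : Fin N) :
    maxMapping μ i = 0 ∨ maxMapping μ i = 1 := by
  unfold maxMapping
  by_cases h : ∀ j ∈ Finset.univ.erase i, stepFn (μ i - μ j) = 1
  · exact Or.inr (Finset.prod_eq_one h)
  · push Not at h
    obtain ⟨j, hj, hne⟩ := h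
    refine Or.inl (Finset.prod_eq_zero hj ?_)
    unfold stepFn at *
    split_ifs at * <;> simp_all

/-- The mode that `Q` selects maximizes. -/
theorem le_of_maxMapping_eq_single {N : ℕ} {μ : Fin N → ℝ} {i : Fin N}
    (h : maxMapping μ = Pi.single i 1) (j : Fin N) : μ j ≤ μ i := by
  by_contra hlt
  have hj : j ≠ i := by rintro rfl; exact hlt le_rfl
  have h1 : maxMapping μ i = 1 := by rw [h, Pi.single_eq_same]
  have h0 : maxMapping μ i = 0 := by
    refine Finset.prod_eq_zero (Finset.mem_erase.2 ⟨hj, Finset.mem_univ j⟩) ?_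
    rw [stepFn, if_neg]
    simpa using hlt
  rw [h1] at h0
  exact one_ne_zero h0

theorem SwitchedSystem.F_single {n N : ℕ} (sys : SwitchedSystem n N) (x : State n) (s : Fin N) :
    sys.F x (Pi.single s 1) = sys.f s x := by
  unfold SwitchedSystem.F
  rw [Finset.sum_eq_single s]
  · simp
  · intro i _ hi; simp [hi]
  · simp

/-! ### The control `Q(u - γ d)` on one cell. -/

namespace Iterate

variable {n N : ℕ} {sys : SwitchedSystem n N} (z : Iterate sys)

theorem d_of_u {t : ℝ} {s : Fin N} (hu : z.u t = Pi.single s 1) (a : Fin N) :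
    z.d a t = inner ℝ (z.ρ t) (sys.f a (z.x t) - sys.f s (z.x t)) := by
  rw [d, hu, sys.F_single]

theorem d_active {t : ℝ} {s : Fin N} (hu : z.u t = Pi.single s 1) : z.d s t = 0 := by
  rw [z.d_of_u hu, sub_self, inner_zero_right]

theorem d_eq_dDiff {t : ℝ} {s : Fin N} (hu : z.u t = Pi.single s 1) (a : Fin N) :
    z.d a t = z.dDiff a s t := by
  rw [dDiff, z.d_active hu, sub_zero]

theorem dDiff_eq (a b : Fin N) (t : ℝ) :
    z.dDiff a b t = inner ℝ (z.ρ t) (sys.f a (z.x t) - sys.f b (z.x t)) := by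
  rw [dDiff, d, d, ← inner_sub_right]
  congr 1
  abel

theorem continuousOn_dDiff (a b : Fin N) : ContinuousOn (z.dDiff a b) (Icc 0 sys.T) := by
  have h : z.dDiff a b = fun t => inner ℝ (z.ρ t) (sys.f a (z.x t) - sys.f b (z.x t)) :=
    funext (z.dDiff_eq a b)
  rw [h]
  exact z.ρ_continuousOn.inner
    (((sys.f_contDiff a).continuous.comp_continuousOn z.feasible.2.1).sub
      ((sys.f_contDiff b).continuous.comp_continuousOn z.feasible.2.1))

theorem θ_le (hθ : z.θ < 0) {t : ℝ} (ht : t ∈ Icc 0 sys.T) (a : Fin N) : z.θ ≤ z.d a t := by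
  refine csInf_le ?_ ⟨a, t, ht, rfl⟩
  by_contra hb
  -- The infimum of a set that is unbounded below is `0` by convention, so `θ < 0` already forces a
  -- lower bound.
  rw [θ, Real.sInf_of_not_bddBelow hb] at hθ
  exact lt_irrefl _ hθ

theorem γ₀_pos (hθ : z.θ < 0) : 0 < z.γ₀ := div_pos_of_neg_of_neg (by norm_num) hθ

theorem maxMapping_stay {γ t : ℝ} {s : Fin N} (hγ : 0 < γ) (hu : z.u t = Pi.single s 1)
    (h : ∀ k, k ≠ s → -1 / γ < z.d k t) : maxMapping (z.μ γ t) = Pi.single s 1 := by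
  refine maxMapping_eq_single fun k hk => ?_
  have h1 := h k hk
  rw [div_lt_iff₀ hγ] at h1
  simp only [μ, hu, Pi.single_eq_same, Pi.single_eq_of_ne hk, z.d_active hu]
  linarith

theorem maxMapping_move {γ t : ℝ} {a s : Fin N} (hγ : 0 < γ) (hu : z.u t = Pi.single s 1)
    (ha : a ≠ s) (h : ∀ k, k ≠ a → z.d a t < z.d k t) (hlt : z.d a t < -1 / γ) :
    maxMapping (z.μ γ t) = Pi.single a 1 := by
  refine maxMapping_eq_single fun k hk => ?_
  rw [lt_div_iff₀ hγ] at hlt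
  simp only [μ, hu, Pi.single_eq_of_ne ha]
  by_cases hks : k = s
  · subst hks
    rw [Pi.single_eq_same, z.d_active hu]
    linarith
  · rw [Pi.single_eq_of_ne hks]
    have := mul_lt_mul_of_pos_left (h k hk) hγ
    linarith

/-- The switching time `h γ` from `a` to `s` leaves the minimizer `c` of `d_a` to the right. -/
def EscapesRight (a s : Fin N) (h : ℝ → ℝ) (c : ℝ) : Prop :=
  ∃ c', c < c' ∧ ContinuousOn (z.dDiff a s) (Icc c c') ∧ StrictMonoOn (z.dDiff a s) (Icc c c') ∧
    z.dDiff a s c = z.θ ∧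
    (∀ t ∈ Ioo c c', DifferentiableAt ℝ (z.dDiff a s) t ∧ z.d a t = z.dDiff a s t) ∧
    (∀ᶠ γ in 𝓝[>] z.γ₀, h γ ∈ Ioo c c' ∧ z.dDiff a s (h γ) = -1 / γ) ∧
    Tendsto h (𝓝[>] z.γ₀) (𝓝 c)

/-- The switching time `h γ` from `s` to `a` leaves the minimizer `c` of `d_a` to the left. -/
def EscapesLeft (s a : Fin N) (h : ℝ → ℝ) (c : ℝ) : Prop :=
  ∃ c', c' < c ∧ ContinuousOn (z.dDiff a s) (Icc c' c) ∧ StrictAntiOn (z.dDiff a s) (Icc c' c) ∧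
    z.dDiff a s c = z.θ ∧
    (∀ t ∈ Ioo c' c, DifferentiableAt ℝ (z.dDiff a s) t ∧ z.d a t = z.dDiff a s t) ∧
    (∀ᶠ γ in 𝓝[>] z.γ₀, h γ ∈ Ioo c' c ∧ z.dDiff a s (h γ) = -1 / γ) ∧
    Tendsto h (𝓝[>] z.γ₀) (𝓝 c)

/-- The ways in which a switching time between the modes `a` and `b` can depend on `γ`. -/
def SwitchKind (a b : Fin N) (h : ℝ → ℝ) (c : ℝ) : Prop :=
  (∀ᶠ γ in 𝓝[>] z.γ₀, h γ = c) ∨ z.EscapesRight a b h c ∨ z.EscapesLeft a b h c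

theorem SwitchKind.congr {z : Iterate sys} {a b : Fin N} {h h' : ℝ → ℝ} {c : ℝ}
    (hk : z.SwitchKind a b h c) (heq : h =ᶠ[𝓝[>] z.γ₀] h') : z.SwitchKind a b h' c := by
  rcases hk with hk | ⟨c', h1, h2, h3, h4, h5, h6, h7⟩ | ⟨c', h1, h2, h3, h4, h5, h6, h7⟩
  · left
    filter_upwards [hk, heq] with γ h1 h2 using h2 ▸ h1
  · refine Or.inr (Or.inl ⟨c', h1, h2, h3, h4, h5, ?_, h7.congr' heq⟩)
    filter_upwards [h6, heq] with γ h1 h2 using h2 ▸ h1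
  · refine Or.inr (Or.inr ⟨c', h1, h2, h3, h4, h5, ?_, h7.congr' heq⟩)
    filter_upwards [h6, heq] with γ h1 h2 using h2 ▸ h1

/-- The times at which `Q(u - γ d)` deviates from `u`. -/
def deviation (γ : ℝ) : Set ℝ := {t | maxMapping (z.μ γ t) ≠ z.u t}

/-- The control `Q(u - γ d)` is, on `(0, g γ)` and for `γ > γ₀` near `γ₀`, that of a schedule with
a constant mode sequence that ends in the mode `b`, and whose switching times have been displaced
by `V γ` at most in total. -/
def ScheduledUpTo (g V : ℝ → ℝ) (b : Fin N) : Prop :=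
  ∃ (L : ℕ) (m : Fin (L + 1) → Fin N) (p : ℝ → Fin L → ℝ) (c : Fin L → ℝ),
    m (Fin.last L) = b ∧ (∀ i : Fin L, m i.castSucc ≠ m i.succ) ∧
    (∀ i : Fin L, z.SwitchKind (m i.castSucc) (m i.succ) (fun γ => p γ i) (c i)) ∧
    ∀ᶠ γ in 𝓝[>] z.γ₀, StrictMono (p γ) ∧ (∀ i, p γ i ∈ Ioo 0 (g γ)) ∧
      (∀ᵐ t, t ∈ Ioo 0 (g γ) → maxMapping (z.μ γ t) = scheduleControl m (p γ) t) ∧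
      ∑ i, |p γ i - c i| ≤ V γ

theorem scheduledUpTo_zero (b : Fin N) {V : ℝ → ℝ} (hV : ∀ γ, 0 ≤ V γ) :
    z.ScheduledUpTo (fun _ => 0) V b :=
  ⟨0, fun _ => b, fun _ i => i.elim0, fun i => i.elim0, rfl, fun i => i.elim0, fun i => i.elim0,
    Eventually.of_forall fun γ => ⟨fun i => i.elim0, fun i => i.elim0,
      Eventually.of_forall fun t ht => absurd (ht.1.trans ht.2) (lt_irrefl _), by simp [hV γ]⟩⟩

variable {z} in
-- The gluing step: `g` becomes a switching time only if the mode really changes there. Its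
-- displacement from `c` is then charged to the increase from `V` to `V'`.
theorem ScheduledUpTo.extend {g g' V V' : ℝ → ℝ} {a b : Fin N} {c : ℝ}
    (h : z.ScheduledUpTo g V b)
    (hk : b = a ∨ (∀ᶠ γ in 𝓝[>] z.γ₀, 0 < g γ) ∧ z.SwitchKind b a g c)
    (hlt : ∀ᶠ γ in 𝓝[>] z.γ₀, g γ < g' γ)
    (hQ : ∀ᶠ γ in 𝓝[>] z.γ₀, ∀ t ∈ Ioo (g γ) (g' γ), maxMapping (z.μ γ t) = Pi.single a 1)
    (hV : ∀ᶠ γ in 𝓝[>] z.γ₀, V γ + |g γ - c| ≤ V' γ) : z.ScheduledUpTo g' V' a := by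
  obtain ⟨L, m, p, c₀, hm, hne, hkind, hev⟩ := h
  by_cases hba : b = a
  · refine ⟨L, m, p, c₀, hm.trans hba, hne, hkind, ?_⟩
    filter_upwards [hev, hlt, hQ, hV] with γ ⟨h1, h2, h3, h4⟩ hlt hQ hV
    refine ⟨h1, fun i => ⟨(h2 i).1, (h2 i).2.trans hlt⟩, ?_, ?_⟩
    -- Nothing is known about the control at the single time `g γ`, which is null.
    · filter_upwards [h3, measure_eq_zero_iff_ae_notMem.1 (measure_singleton (μ := volume) (g γ))]
        with t ht htg htI
      rcases lt_or_gt_of_ne htg with h | h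
      · exact ht ⟨htI.1, h⟩
      · rw [hQ t ⟨h, htI.2⟩, scheduleControl,
          activeIndex_eq_last fun i => ((h2 i).2.trans h).le, hm, hba]
    · linarith [abs_nonneg (g γ - c)]
  · obtain ⟨hg0, hk⟩ := hk.resolve_left hba
    refine ⟨L + 1, Fin.snoc m a, fun γ => Fin.snoc (p γ) (g γ), Fin.snoc c₀ c, by simp, ?_, ?_, ?_⟩
    · intro i
      refine Fin.lastCases ?_ (fun j => ?_) i
      · rw [Fin.succ_last, Fin.snoc_last, Fin.snoc_castSucc, hm]
        exact hba
      · rw [Fin.succ_castSucc, Fin.snoc_castSucc, Fin.snoc_castSucc]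
        exact hne j
    · intro i
      refine Fin.lastCases ?_ (fun j => ?_) i
      · simp only [Fin.succ_last, Fin.snoc_last, Fin.snoc_castSucc, hm]
        exact hk
      · simp only [Fin.succ_castSucc, Fin.snoc_castSucc]
        exact hkind j
    · filter_upwards [hev, hlt, hQ, hV, hg0] with γ ⟨h1, h2, h3, h4⟩ hlt hQ hV hg0
      refine ⟨?_, ?_, ?_, ?_⟩
      · intro i j hij
        induction j using Fin.lastCases with
        | last =>
          induction i using Fin.lastCases with
          | last => exact absurd hij (lt_irrefl _)
          | cast i => simpa using (h2 i).2
        | cast j =>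
          induction i using Fin.lastCases with
          | last => exact absurd (hij.trans (Fin.castSucc_lt_last j)) (lt_irrefl _)
          | cast i => simpa using h1 (Fin.castSucc_lt_castSucc_iff.1 hij)
      · intro i
        induction i using Fin.lastCases with
        | last => simpa using ⟨hg0, hlt⟩
        | cast i => simpa using ⟨(h2 i).1, (h2 i).2.trans hlt⟩
      · filter_upwards [h3, measure_eq_zero_iff_ae_notMem.1 (measure_singleton (μ := volume) (g γ))]
          with t ht htg htI
        rcases lt_or_gt_of_ne htg with h | h
        · rw [ht ⟨htI.1, h⟩, scheduleControl, scheduleControl, activeIndex_snoc_of_lt h,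
            Fin.snoc_castSucc]
        · rw [hQ t ⟨h, htI.2⟩, scheduleControl, activeIndex_eq_last, Fin.snoc_last]
          intro i
          induction i using Fin.lastCases with
          | last => simpa using h.le
          | cast i => simpa using ((h2 i).2.trans h).le
      · rw [Fin.sum_univ_castSucc]
        simp only [Fin.snoc_castSucc, Fin.snoc_last]
        linarith

/-- `(q, q')` lies in one dwelling interval of the schedule, and the modes are strictly ordered
by their insertion gradients there, whose differences are strictly monotone. -/
structure IsCell (q q' : ℝ) (s : Fin N) : Prop where
  nonneg : 0 ≤ q
  lt : q < q'
  le : q' ≤ sys.T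
  u_eq : ∀ t ∈ Ioo q q', z.u t = Pi.single s 1
  differentiableAt : ∀ a b, a ≠ b → ∀ t ∈ Ioo q q', DifferentiableAt ℝ (z.dDiff a b) t
  deriv_ne : ∀ a b, a ≠ b → ∀ t ∈ Ioo q q', deriv (z.dDiff a b) t ≠ 0
  ne_zero : ∀ a b, a ≠ b → ∀ t ∈ Ioo q q', z.dDiff a b t ≠ 0

variable {z} {q q' : ℝ} {s : Fin N}

theorem IsCell.Icc_subset (hc : z.IsCell q q' s) : Icc q q' ⊆ Icc 0 sys.T :=
  Icc_subset_Icc hc.nonneg hc.le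

/-- A mode that is minimal at one time of the cell stays so: overtaking would produce a zero of some
`d_{ka}`. -/
theorem IsCell.exists_argmin (hc : z.IsCell q q' s) :
    ∃ a, ∀ t ∈ Ioo q q', ∀ k, k ≠ a → z.d a t < z.d k t := by
  have : Nonempty (Fin N) := ⟨s⟩
  obtain ⟨t₀, ht₀⟩ := nonempty_Ioo.2 hc.lt
  obtain ⟨a, ha⟩ := Finite.exists_min fun a => z.d a t₀
  refine ⟨a, fun t ht k hk => ?_⟩
  have hcont : ContinuousOn (z.dDiff k a) (Ioo q q') :=
    (z.continuousOn_dDiff k a).mono (Ioo_subset_Icc_self.trans hc.Icc_subset)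
  by_contra hle
  have h0 : (0 : ℝ) ∈ Icc (z.dDiff k a t) (z.dDiff k a t₀) := by
    constructor
    · rw [dDiff]; linarith
    · rw [dDiff]; linarith [ha k]
  obtain ⟨r, hr, hr0⟩ := isPreconnected_Ioo.intermediate_value ht ht₀ hcont h0
  exact hc.ne_zero k a hk r hr hr0

/-- A derivative without zeros has constant sign by Darboux's theorem, without being continuous. -/
theorem IsCell.strictMonoOn_or_strictAntiOn (hc : z.IsCell q q' s) {a b : Fin N} (hab : a ≠ b) :
    StrictMonoOn (z.dDiff a b) (Icc q q') ∨ StrictAntiOn (z.dDiff a b) (Icc q q') := by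
  have hcont := (z.continuousOn_dDiff a b).mono hc.Icc_subset
  rcases hasDerivWithinAt_forall_lt_or_forall_gt_of_forall_ne (convex_Ioo q q')
    (fun t ht => (hc.differentiableAt a b hab t ht).hasDerivAt.hasDerivWithinAt) (m := 0)
    (hc.deriv_ne a b hab) with h | h
  · exact Or.inr (strictAntiOn_of_deriv_neg (convex_Icc _ _) hcont (by simpa using h))
  · exact Or.inl (strictMonoOn_of_deriv_pos (convex_Icc _ _) hcont (by simpa using h))

/-- With `a` the least mode, `Q` keeps `s` where `d_{as} > -1/γ` and takes `a` where `d_{as} <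
-1/γ`. A strictly monotone `d_{as} ≥ θ` falls below a level just above `θ` only next to an endpoint
at which it equals `θ`. -/
theorem IsCell.trichotomy (hc : z.IsCell q q' s) (hθ : z.θ < 0) :
    (∀ᶠ γ in 𝓝[>] z.γ₀, ∀ t ∈ Ioo q q', maxMapping (z.μ γ t) = Pi.single s 1) ∨
    (∃ a h, a ≠ s ∧ z.EscapesRight a s h q ∧ ∀ᶠ γ in 𝓝[>] z.γ₀, h γ ∈ Ioo q q' ∧
      (∀ t ∈ Ioo q (h γ), maxMapping (z.μ γ t) = Pi.single a 1) ∧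
      ∀ t ∈ Ioo (h γ) q', maxMapping (z.μ γ t) = Pi.single s 1) ∨
    ∃ a h, a ≠ s ∧ z.EscapesLeft s a h q' ∧ ∀ᶠ γ in 𝓝[>] z.γ₀, h γ ∈ Ioo q q' ∧
      (∀ t ∈ Ioo q (h γ), maxMapping (z.μ γ t) = Pi.single s 1) ∧
      ∀ t ∈ Ioo (h γ) q', maxMapping (z.μ γ t) = Pi.single a 1 := by
  have hpos : ∀ᶠ γ in 𝓝[>] z.γ₀, 0 < γ := by
    filter_upwards [self_mem_nhdsWithin] with γ hγ using (z.γ₀_pos hθ).trans hγ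
  obtain ⟨a, ha⟩ := hc.exists_argmin
  by_cases has : a = s
  · left
    filter_upwards [hpos] with γ hγ t ht
    refine z.maxMapping_stay hγ (hc.u_eq t ht) fun k hk => ?_
    have h1 := ha t ht k (has ▸ hk)
    rw [has, z.d_active (hc.u_eq t ht)] at h1
    exact (div_neg_of_neg_of_pos (by norm_num) hγ).trans h1
  have hcont := (z.continuousOn_dDiff a s).mono hc.Icc_subset
  have hd : ∀ t ∈ Ioo q q', z.d a t = z.dDiff a s t := fun t ht => z.d_eq_dDiff (hc.u_eq t ht) a
  -- At an endpoint another mode may be active and `d_a ≠ d_{as}`, so the bound comes from the open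
  -- cell by continuity.
  have hge : ∀ t ∈ Icc q q', z.θ ≤ z.dDiff a s t := by
    intro t ht
    rw [← closure_Ioo hc.lt.ne] at ht hcont
    refine le_on_closure (f := fun _ => z.θ) (fun t ht => ?_) continuousOn_const hcont ht
    exact hd t ht ▸ z.θ_le hθ (hc.Icc_subset (Ioo_subset_Icc_self ht)) a
  have hstay : ∀ γ, 0 < γ → ∀ t ∈ Ioo q q', -1 / γ < z.dDiff a s t →
      maxMapping (z.μ γ t) = Pi.single s 1 := by
    intro γ hγ t ht hlt
    refine z.maxMapping_stay hγ (hc.u_eq t ht) fun k hk => ?_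
    rw [← hd t ht] at hlt
    by_cases hka : k = a
    · exact hka ▸ hlt
    · exact hlt.trans (ha t ht k hka)
  have hmove : ∀ γ, 0 < γ → ∀ t ∈ Ioo q q', z.dDiff a s t < -1 / γ →
      maxMapping (z.μ γ t) = Pi.single a 1 := by
    intro γ hγ t ht hlt
    exact z.maxMapping_move hγ (hc.u_eq t ht) has (ha t ht) (hd t ht ▸ hlt)
  have hinfo : ∀ t ∈ Ioo q q', DifferentiableAt ℝ (z.dDiff a s) t ∧ z.d a t = z.dDiff a s t :=
    fun t ht => ⟨hc.differentiableAt a s has t ht, hd t ht⟩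
  have hleft : q ∈ Icc q q' := ⟨le_rfl, hc.lt.le⟩
  have hright : q' ∈ Icc q q' := ⟨hc.lt.le, le_rfl⟩
  have hlim := (tendsto_neg_one_div_nhdsGT' hθ).mono_right nhdsWithin_le_nhds
  rcases hc.strictMonoOn_or_strictAntiOn has with hmono | hanti
  · rcases (hge q hleft).eq_or_lt with heq | hlt
    · right; left
      obtain ⟨h, h1, h2⟩ := exists_level_right hθ hc.lt hcont hmono heq.symm
      refine ⟨a, h, has, ⟨q', hc.lt, hcont, hmono, heq.symm, hinfo, h1, h2⟩, ?_⟩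
      filter_upwards [hpos, h1] with γ hγ hh
      have hhI := Ioo_subset_Icc_self hh.1
      refine ⟨hh.1, fun t ht => ?_, fun t ht => ?_⟩
      · have ht' : t ∈ Ioo q q' := ⟨ht.1, ht.2.trans hh.1.2⟩
        exact hmove γ hγ t ht' (hh.2 ▸ hmono (Ioo_subset_Icc_self ht') hhI ht.2)
      · have ht' : t ∈ Ioo q q' := ⟨hh.1.1.trans ht.1, ht.2⟩
        exact hstay γ hγ t ht' (hh.2 ▸ hmono hhI (Ioo_subset_Icc_self ht') ht.1)
    · left
      filter_upwards [hpos, hlim.eventually (Iio_mem_nhds hlt)] with γ hγ h1 t ht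
      exact hstay γ hγ t ht (lt_trans h1 (hmono hleft (Ioo_subset_Icc_self ht) ht.1))
  · rcases (hge q' hright).eq_or_lt with heq | hlt
    · right; right
      obtain ⟨h, h1, h2⟩ := exists_level_left hθ hc.lt hcont hanti heq.symm
      refine ⟨a, h, has, ⟨q, hc.lt, hcont, hanti, heq.symm, hinfo, h1, h2⟩, ?_⟩
      filter_upwards [hpos, h1] with γ hγ hh
      have hhI := Ioo_subset_Icc_self hh.1
      refine ⟨hh.1, fun t ht => ?_, fun t ht => ?_⟩
      · have ht' : t ∈ Ioo q q' := ⟨ht.1, ht.2.trans hh.1.2⟩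
        exact hstay γ hγ t ht' (hh.2 ▸ hanti (Ioo_subset_Icc_self ht') hhI ht.2)
      · have ht' : t ∈ Ioo q q' := ⟨hh.1.1.trans ht.1, ht.2⟩
        exact hmove γ hγ t ht' (hh.2 ▸ hanti hhI (Ioo_subset_Icc_self ht') ht.1)
    · left
      filter_upwards [hpos, hlim.eventually (Iio_mem_nhds hlt)] with γ hγ h1 t ht
      exact hstay γ hγ t ht (lt_trans h1 (hanti (Ioo_subset_Icc_self ht) hright ht.2))

end Iterate

/-! ### Deviation time and the assembly of the cells into a schedule. -/

namespace Iterate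

variable {n N : ℕ} {sys : SwitchedSystem n N} (z : Iterate sys)

/-- The length of time in `(0, q)` during which `Q(u - γ d)` deviates from `u`. -/
def deviationTime (q γ : ℝ) : ℝ := volume.real (z.deviation γ ∩ Ioo 0 q)

theorem deviationTime_nonneg (q γ : ℝ) : 0 ≤ z.deviationTime q γ := measureReal_nonneg

theorem volume_deviation_inter_ne_top (γ q : ℝ) : volume (z.deviation γ ∩ Ioo 0 q) ≠ ⊤ :=
  measure_ne_top_of_subset inter_subset_right (by simp)

theorem deviationTime_add_le {γ q l r q' : ℝ} (hq : 0 ≤ q) (hql : q ≤ l) (hlr : l ≤ r)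
    (hr : r ≤ q') (h : Ioo l r ⊆ z.deviation γ) :
    z.deviationTime q γ + (r - l) ≤ z.deviationTime q' γ := by
  have hdisj : Disjoint (z.deviation γ ∩ Ioo 0 q) (Ioo l r) := by
    refine Set.disjoint_left.2 fun t ht ht' => ?_
    linarith [ht.2.2, ht'.1]
  have hvol : volume.real (Ioo l r) = r - l := by
    rw [Measure.real, Real.volume_Ioo, ENNReal.toReal_ofReal (sub_nonneg.2 hlr)]
  -- Additivity only needs the interval to be measurable, not the deviation set.
  rw [deviationTime, deviationTime, ← hvol,
    ← measureReal_union hdisj measurableSet_Ioo (z.volume_deviation_inter_ne_top γ q) (by simp)]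
  refine measureReal_mono ?_ (z.volume_deviation_inter_ne_top γ q')
  rintro t (ht | ht)
  · exact ⟨ht.1, ht.2.1, by linarith [ht.2.2]⟩
  · exact ⟨h ht, by linarith [ht.1], by linarith [ht.2]⟩

theorem deviationTime_le_add {γ q l r q' : ℝ} (hlr : l ≤ r)
    (h : ∀ t ∈ Ioo q q', t ∉ Icc l r → t ∉ z.deviation γ) :
    z.deviationTime q' γ ≤ z.deviationTime q γ + (r - l) := by
  have hvol : volume.real (Icc l r ∪ {q}) = r - l := by
    have : volume (Icc l r ∪ {q}) = volume (Icc l r) :=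
      le_antisymm ((measure_union_le _ _).trans (by simp)) (measure_mono subset_union_left)
    rw [Measure.real, this, Real.volume_Icc, ENNReal.toReal_ofReal (sub_nonneg.2 hlr)]
  rw [deviationTime, deviationTime, ← hvol]
  refine (measureReal_mono ?_ ?_).trans (measureReal_union_le _ _)
  · rintro t ⟨ht, ht'⟩
    rcases lt_trichotomy t q with htq | htq | htq
    · exact Or.inl ⟨ht, ht'.1, htq⟩
    · exact Or.inr (Or.inr htq)
    · by_contra hn
      exact h t ⟨htq, ht'.2⟩ (fun hI => hn (Or.inr (Or.inl hI))) ht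
  · exact measure_union_ne_top (z.volume_deviation_inter_ne_top γ q)
      (measure_union_ne_top (by simp) (by simp))

variable {z} {q q' : ℝ} {s : Fin N}

theorem single_one_ne {a s : Fin N} (h : a ≠ s) :
    (Pi.single a 1 : Fin N → ℝ) ≠ Pi.single s 1 := by
  intro heq
  have := congrFun heq a
  simp [h] at this

/-- The form of `h` treats the start of time apart: at `q = 0` no switching is allowed, but the
empty schedule may end in any prescribed mode. At `q > 0` a change of mode makes `q` a frozen
switching time. -/
theorem IsCell.scheduledUpTo (hc : z.IsCell q q' s) (hθ : z.θ < 0)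
    (h : ∀ a, ∃ b, z.ScheduledUpTo (fun _ => q) (z.deviationTime q) b ∧ (b = a ∨ 0 < q)) :
    ∃ b, z.ScheduledUpTo (fun _ => q') (z.deviationTime q') b := by
  have hstep : ∀ {a g' V'}, (∀ᶠ γ in 𝓝[>] z.γ₀, q < g' γ) →
      (∀ᶠ γ in 𝓝[>] z.γ₀, ∀ t ∈ Ioo q (g' γ), maxMapping (z.μ γ t) = Pi.single a 1) →
      (∀ᶠ γ in 𝓝[>] z.γ₀, z.deviationTime q γ ≤ V' γ) → z.ScheduledUpTo g' V' a := by
    intro a g' V' h1 h2 h3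
    obtain ⟨b, hb, hor⟩ := h a
    refine hb.extend (c := q) ?_ h1 h2 (by simpa using h3)
    exact hor.imp_right fun h0 =>
      ⟨Eventually.of_forall fun _ => h0, Or.inl (Eventually.of_forall fun _ => rfl)⟩
  have hpos : 0 < q' := hc.nonneg.trans_lt hc.lt
  rcases hc.trichotomy hθ with hA | ⟨a, h, has, hesc, hB⟩ | ⟨a, h, has, hesc, hC⟩
  · refine ⟨s, hstep (Eventually.of_forall fun _ => hc.lt) hA (Eventually.of_forall fun γ => ?_)⟩
    simpa using z.deviationTime_add_le (γ := γ) hc.nonneg le_rfl le_rfl hc.lt.le (by simp)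
  · have h1 : z.ScheduledUpTo h (z.deviationTime q) a :=
      hstep (hB.mono fun γ h => h.1.1) (hB.mono fun γ h => h.2.1)
        (Eventually.of_forall fun _ => le_rfl)
    refine ⟨s, h1.extend (c := q) (Or.inr ⟨hB.mono fun γ h => hc.nonneg.trans_lt h.1.1,
      Or.inr (Or.inl hesc)⟩) (hB.mono fun γ h => h.1.2) (hB.mono fun γ h => h.2.2) ?_⟩
    filter_upwards [hB] with γ ⟨hI, hdev, _⟩
    rw [abs_of_pos (sub_pos.2 hI.1)]
    -- The displacement is paid for by the interval `(q, h γ)`, on which `a` has replaced `s`.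
    refine z.deviationTime_add_le hc.nonneg le_rfl hI.1.le hI.2.le fun t ht => ?_
    rw [deviation, mem_ofPred_eq, hdev t ht, hc.u_eq t ⟨ht.1, ht.2.trans hI.2⟩]
    exact single_one_ne has
  · have h1 : z.ScheduledUpTo h (z.deviationTime q) s :=
      hstep (hC.mono fun γ h => h.1.1) (hC.mono fun γ h => h.2.1)
        (Eventually.of_forall fun _ => le_rfl)
    refine ⟨a, h1.extend (c := q') (Or.inr ⟨hC.mono fun γ h => hc.nonneg.trans_lt h.1.1,
      Or.inr (Or.inr hesc)⟩) (hC.mono fun γ h => h.1.2) (hC.mono fun γ h => h.2.2) ?_⟩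
    filter_upwards [hC] with γ ⟨hI, _, hdev⟩
    rw [abs_of_neg (sub_neg.2 hI.2), neg_sub]
    refine z.deviationTime_add_le hc.nonneg hI.1.le hI.2.le le_rfl fun t ht => ?_
    rw [deviation, mem_ofPred_eq, hdev t ht, hc.u_eq t ⟨hI.1.trans ht.1, ht.2⟩]
    exact single_one_ne has

theorem IsCell.tendsto_deviationTime (hc : z.IsCell q q' s) (hθ : z.θ < 0)
    (h : Tendsto (z.deviationTime q) (𝓝[>] z.γ₀) (𝓝 0)) :
    Tendsto (z.deviationTime q') (𝓝[>] z.γ₀) (𝓝 0) := by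
  have key : ∀ l r : ℝ → ℝ, Tendsto (fun γ => r γ - l γ) (𝓝[>] z.γ₀) (𝓝 0) →
      (∀ᶠ γ in 𝓝[>] z.γ₀, l γ ≤ r γ ∧
        ∀ t ∈ Ioo q q', t ∉ Icc (l γ) (r γ) → maxMapping (z.μ γ t) = Pi.single s 1) →
      Tendsto (z.deviationTime q') (𝓝[>] z.γ₀) (𝓝 0) := by
    intro l r hlim hev
    refine tendsto_of_tendsto_of_tendsto_of_le_of_le' tendsto_const_nhds
      (by simpa using h.add hlim) (Eventually.of_forall fun γ => z.deviationTime_nonneg q' γ) ?_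
    filter_upwards [hev] with γ hγ
    refine z.deviationTime_le_add hγ.1 fun t ht hn hdev => hdev ?_
    rw [hγ.2 t ht hn, hc.u_eq t ht]
  rcases hc.trichotomy hθ with hA | ⟨a, h, has, hesc, hB⟩ | ⟨a, h, has, hesc, hC⟩
  · exact key (fun _ => q) (fun _ => q) (by simp) (hA.mono fun γ h => ⟨le_rfl, fun t ht _ => h t ht⟩)
  · obtain ⟨-, -, -, -, -, -, -, hlim⟩ := hesc
    refine key (fun _ => q) h (by simpa using hlim.sub_const q) ?_
    filter_upwards [hB] with γ hγ
    refine ⟨hγ.1.1.le, fun t ht hn => hγ.2.2 t ⟨?_, ht.2⟩⟩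
    by_contra hle
    exact hn ⟨ht.1.le, not_lt.1 hle⟩
  · obtain ⟨-, -, -, -, -, -, -, hlim⟩ := hesc
    refine key h (fun _ => q') (by simpa using hlim.const_sub q') ?_
    filter_upwards [hC] with γ hγ
    refine ⟨hγ.1.2.le, fun t ht hn => hγ.2.1 t ⟨ht.1, ?_⟩⟩
    by_contra hle
    exact hn ⟨not_lt.1 hle, ht.2.le⟩

variable (z)

/-- The points that delimit the cells. -/
def cellBoundary : Set ℝ :=
  {0, sys.T} ∪ range z.τ ∪ ⋃ a, ⋃ b, ⋃ (_ : a ≠ b),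
    ({t ∈ Icc 0 sys.T | ¬ DifferentiableAt ℝ (z.dDiff a b) t ∨ deriv (z.dDiff a b) t = 0} ∪
      {t ∈ Icc 0 sys.T | z.dDiff a b t = 0})

variable {z}

/-- By Rolle's theorem critical points separate the zeros of `d_{ab}`, so there are finitely many
zeros too. -/
theorem FinitelyManyCriticalPoints.finite_cellBoundary (hcrit : z.FinitelyManyCriticalPoints) :
    z.cellBoundary.Finite := by
  refine ((by simp : Set.Finite {0, sys.T}).union (finite_range _)).union ?_
  refine finite_iUnion fun a => finite_iUnion fun b => finite_iUnion fun hab => ?_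
  refine (hcrit a b hab).union (Set.Finite.of_separated (hcrit a b hab) ?_)
  intro t ht r hr htr
  have hsub : Icc t r ⊆ Icc 0 sys.T := Icc_subset_Icc ht.1.1 hr.1.2
  obtain ⟨c, hc, hc0⟩ := exists_deriv_eq_zero htr ((z.continuousOn_dDiff a b).mono hsub)
    (ht.2.trans hr.2.symm)
  exact ⟨c, ⟨hsub (Ioo_subset_Icc_self hc), Or.inr hc0⟩, hc⟩

theorem exists_isCell (hq : 0 ≤ q) (hqq : q < q') (hq' : q' ≤ sys.T)
    (h : ∀ t ∈ Ioo q q', t ∉ z.cellBoundary) : ∃ s, z.IsCell q q' s := by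
  obtain ⟨t₀, ht₀⟩ := nonempty_Ioo.2 hqq
  have hI : Ioo q q' ⊆ Icc 0 sys.T := Ioo_subset_Icc_self.trans (Icc_subset_Icc hq hq')
  have hτ : ∀ t ∈ Ioo q q', ∀ j, z.τ j ≤ t → z.τ j ≤ q := by
    intro t ht j hj
    by_contra hjq
    exact h (z.τ j) ⟨not_le.1 hjq, hj.trans_lt ht.2⟩ (Or.inl (Or.inr ⟨j, rfl⟩))
  have hmem : ∀ a b, a ≠ b → ∀ t ∈ Ioo q q',
      ¬ (¬ DifferentiableAt ℝ (z.dDiff a b) t ∨ deriv (z.dDiff a b) t = 0) ∧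
        z.dDiff a b t ≠ 0 := by
    intro a b hab t ht
    constructor
    · intro hor
      exact h t ht (Or.inr (mem_iUnion.2 ⟨a, mem_iUnion.2 ⟨b, mem_iUnion.2
        ⟨hab, Or.inl ⟨hI ht, hor⟩⟩⟩⟩))
    · intro h0
      exact h t ht (Or.inr (mem_iUnion.2 ⟨a, mem_iUnion.2 ⟨b, mem_iUnion.2
        ⟨hab, Or.inr ⟨hI ht, h0⟩⟩⟩⟩))
  refine ⟨z.σ (activeIndex z.τ t₀), hq, hqq, hq', fun t ht => ?_, fun a b hab t ht => ?_,
    fun a b hab t ht h0 => (hmem a b hab t ht).1 (Or.inr h0), fun a b hab t ht =>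
    (hmem a b hab t ht).2⟩
  · rw [u, scheduleControl, activeIndex_congr fun j => ⟨fun hj => (hτ t ht j hj).trans ht₀.1.le,
      fun hj => (hτ t₀ ht₀ j hj).trans ht.1.le⟩]
  · by_contra hnd
    exact (hmem a b hab t ht).1 (Or.inl hnd)

theorem FinitelyManyCriticalPoints.scheduledUpTo (hcrit : z.FinitelyManyCriticalPoints)
    (hθ : z.θ < 0) :
    (∃ b, z.ScheduledUpTo (fun _ => sys.T) (z.deviationTime sys.T) b) ∧
      Tendsto (z.deviationTime sys.T) (𝓝[>] z.γ₀) (𝓝 0) := by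
  have hB : ∀ t, t ∈ hcrit.finite_cellBoundary.toFinset ↔ t ∈ z.cellBoundary := by simp
  have hmain := consecutive_induction hcrit.finite_cellBoundary.toFinset
    (fun q => q ≤ sys.T →
      (∀ a, ∃ b, z.ScheduledUpTo (fun _ => q) (z.deviationTime q) b ∧ (b = a ∨ 0 < q)) ∧
        Tendsto (z.deviationTime q) (𝓝[>] z.γ₀) (𝓝 0))
    ((hB 0).2 (Or.inl (Or.inl (Or.inl rfl))))
    (fun _ => ⟨fun a => ⟨a, z.scheduledUpTo_zero a (z.deviationTime_nonneg 0), Or.inl rfl⟩, by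
      have : z.deviationTime 0 = fun _ => 0 := funext fun γ => by simp [deviationTime]
      rw [this]
      exact tendsto_const_nhds⟩)
    (fun q q' hq hqB hq'B hqq hne hP hq' => by
      obtain ⟨s, hc⟩ := exists_isCell hq hqq hq' fun t ht htB => hne t ht ((hB t).2 htB)
      obtain ⟨h1, h2⟩ := hP (hqq.le.trans hq')
      obtain ⟨b, hb⟩ := hc.scheduledUpTo hθ h1
      exact ⟨fun a => ⟨b, hb, Or.inr (hq.trans_lt hqq)⟩, hc.tendsto_deviationTime hθ h2⟩)
  obtain ⟨h1, h2⟩ := hmain sys.T ((hB _).2 (Or.inl (Or.inl (Or.inr rfl)))) sys.T_pos.le le_rfl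
  obtain ⟨a⟩ : Nonempty (Fin N) := ⟨z.σ 0⟩
  exact ⟨(h1 a).imp fun b hb => hb.1, h2⟩

theorem nonempty_initialSchedule (hcrit : z.FinitelyManyCriticalPoints) (hθ : z.θ < 0) :
    Nonempty z.InitialSchedule := by
  obtain ⟨⟨b, L, m, p, c, -, hne, -, hev⟩, -⟩ := hcrit.scheduledUpTo hθ
  refine ⟨⟨L, m, p, ?_⟩⟩
  filter_upwards [hev] with γ ⟨h1, h2, h3, _⟩
  refine ⟨⟨h1, h2, hne⟩, ?_⟩
  rw [← restrict_Ioo_eq_restrict_Icc]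
  exact (ae_restrict_iff' measurableSet_Ioo).2 h3

/-- The switching times of an initial schedule are fixed or leave a minimizer, and they have been
displaced at most by the deviation time in total. -/
theorem InitialSchedule.exists_switchKind (hcrit : z.FinitelyManyCriticalPoints) (hθ : z.θ < 0)
    (S : z.InitialSchedule) : ∃ c : Fin S.K → ℝ,
      (∀ i, z.SwitchKind (S.σ i.castSucc) (S.σ i.succ) (fun γ => S.τ γ i) (c i)) ∧
      ∀ᶠ γ in 𝓝[>] z.γ₀, ∑ i, |S.τ γ i - c i| ≤ z.deviationTime sys.T γ := by
  obtain ⟨⟨b, L, m, p, c, -, hne, hkind, hev⟩, -⟩ := hcrit.scheduledUpTo hθ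
  obtain ⟨K, σ, τ, hS⟩ := S
  dsimp only
  have hboth : ∀ᶠ γ in 𝓝[>] z.γ₀, IsModeSchedule sys.T σ (τ γ) ∧ IsModeSchedule sys.T m (p γ) ∧
      (∀ᵐ t, t ∈ Ioo 0 sys.T → scheduleControl σ (τ γ) t = scheduleControl m (p γ) t) ∧
      ∑ i, |p γ i - c i| ≤ z.deviationTime sys.T γ := by
    filter_upwards [hev, hS] with γ ⟨h1, h2, h3, h4⟩ ⟨h5, h6⟩
    refine ⟨h5, ⟨h1, h2, hne⟩, ?_, h4⟩
    rw [← restrict_Ioo_eq_restrict_Icc] at h6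
    filter_upwards [h3, (ae_restrict_iff' measurableSet_Ioo).1 h6] with t ht ht' hI
    rw [← ht hI, ht' hI]
  -- Neither mode sequence depends on `γ`, so a single step identifies them; only the times have to
  -- be compared for all `γ` near `γ₀`.
  obtain ⟨γ₁, hγ₁⟩ := hboth.exists
  obtain rfl : K = L := hγ₁.1.card_eq hγ₁.2.1 hγ₁.2.2.1
  have hτ : ∀ᶠ γ in 𝓝[>] z.γ₀, p γ = τ γ :=
    hboth.mono fun γ h => (h.1.times_eq h.2.1 h.2.2.1).symm
  have hτ₁ := hγ₁.1.times_eq hγ₁.2.1 hγ₁.2.2.1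
  have hmodes := hγ₁.1.modes_eq (σ' := m) (by rw [hτ₁]; exact hτ₁ ▸ hγ₁.2.2.1)
  refine ⟨c, fun i => ?_, ?_⟩
  · rw [(hmodes i).1, (hmodes i).2]
    exact (hkind i).congr (hτ.mono fun γ h => congrFun h i)
  · filter_upwards [hboth, hτ] with γ h h'
    rw [← h']
    exact h.2.2.2

end Iterate

/-! ### Existence and stability of switched trajectories. -/

section Switched

variable {N K : ℕ} {E : Type*} [NormedAddCommGroup E]

theorem measurable_mode (σ : Fin (K + 1) → Fin N) (τ : Fin K → ℝ) :
    Measurable fun t => σ (activeIndex τ t) :=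
  (measurable_from_top (f := σ)).comp (measurable_activeIndex τ)

theorem intervalIntegrable_switched {A : ℝ → Fin N} (hA : Measurable A) {G : Fin N → E → E}
    (hG : ∀ i, Continuous (G i)) {y : ℝ → E} {a b : ℝ} (hab : a ≤ b)
    (hy : ContinuousOn y (Icc a b)) :
    IntervalIntegrable (fun s => G (A s) (y s)) volume a b := by
  rw [intervalIntegrable_iff_integrableOn_Icc_of_le hab]
  exact integrableOn_switched hA (g := fun i s => G i (y s)) fun i => (hG i).comp_continuousOn hy

variable [NormedSpace ℝ E] [CompleteSpace E]

/-- Switched systems with bounded Lipschitz modes have solutions. -/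
theorem exists_switched_solution {G : Fin N → E → E} {Λ : NNReal} {M : ℝ}
    (hG : ∀ i, LipschitzWith Λ (G i)) (hM : ∀ i x, ‖G i x‖ ≤ M) (σ : Fin (K + 1) → Fin N)
    (τ : Fin K → ℝ) {T : ℝ} (hT : 0 ≤ T) (x₀ : E) :
    ∃ y : ℝ → E, ContinuousOn y (Icc 0 T) ∧
      ∀ t ∈ Icc 0 T, y t = x₀ + ∫ s in (0 : ℝ)..t, G (σ (activeIndex τ s)) (y s) := by
  classical
  have hGc : ∀ i, Continuous (G i) := fun i => (hG i).continuous
  have hA := measurable_mode σ τ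
  refine consecutive_induction (insert 0 (insert T (Finset.univ.image τ)))
    (fun q => ∃ y : ℝ → E, ContinuousOn y (Icc 0 q) ∧
      ∀ t ∈ Icc 0 q, y t = x₀ + ∫ s in (0 : ℝ)..t, G (σ (activeIndex τ s)) (y s))
    (by simp) ?_ ?_ T (by simp) hT
  · refine ⟨fun _ => x₀, continuousOn_const, fun t ht => ?_⟩
    obtain rfl : t = 0 := le_antisymm ht.2 ht.1
    simp
  · rintro q q' hq - - hqq hne ⟨y, hy, hyeq⟩
    obtain ⟨t₀, ht₀⟩ := nonempty_Ioo.2 hqq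
    set i := σ (activeIndex τ t₀) with hi
    have hτ : ∀ t ∈ Ioo q q', ∀ j, τ j ≤ t → τ j ≤ q := by
      intro t ht j hj
      by_contra hjq
      exact hne (τ j) ⟨not_le.1 hjq, hj.trans_lt ht.2⟩ (by simp)
    have hconst : ∀ t ∈ Ioo q q', σ (activeIndex τ t) = i := by
      intro t ht
      rw [hi, activeIndex_congr fun j => ⟨fun hj => (hτ t ht j hj).trans ht₀.1.le,
        fun hj => (hτ t₀ ht₀ j hj).trans ht.1.le⟩]
    obtain ⟨w, hw0, hw⟩ := exists_solution_of_lipschitz_of_bounded (hG i) (hM i) hqq.le (y q)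
    have hwc : ContinuousOn w (Icc q q') := fun t ht => (hw t ht).continuousWithinAt
    let Y : ℝ → E := fun t => if t ≤ q then y t else w t
    have hYy : EqOn Y y (Icc 0 q) := fun t ht => if_pos ht.2
    have hYw : EqOn Y w (Icc q q') := by
      intro t ht
      by_cases htq : t ≤ q
      · obtain rfl : t = q := le_antisymm htq ht.1
        simp [Y, hw0]
      · exact if_neg htq
    have hYc : ContinuousOn Y (Icc 0 q') := by
      rw [← Icc_union_Icc_eq_Icc hq hqq.le]
      exact (hy.congr hYy).union_of_isClosed (hwc.congr hYw) isClosed_Icc isClosed_Icc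
    have hfirst : ∀ t ∈ Icc 0 q, Y t = x₀ + ∫ s in (0 : ℝ)..t, G (σ (activeIndex τ s)) (Y s) := by
      intro t ht
      rw [hYy ht, hyeq t ht]
      congr 1
      refine intervalIntegral.integral_congr fun s hs => ?_
      rw [uIcc_of_le ht.1] at hs
      simp only [hYy ⟨hs.1, hs.2.trans ht.2⟩]
    refine ⟨Y, hYc, fun t ht => ?_⟩
    rcases le_total t q with htq | htq
    · exact hfirst t ⟨ht.1, htq⟩
    · have h1 := intervalIntegrable_switched hA hGc hq (hYc.mono (Icc_subset_Icc_right hqq.le))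
      have h2 := intervalIntegrable_switched hA hGc htq (hYc.mono (Icc_subset_Icc hq ht.2))
      rw [← intervalIntegral.integral_add_adjacent_intervals h1 h2, ← add_assoc,
        ← hfirst q ⟨hq, le_rfl⟩]
      have hsub : Icc q t ⊆ Icc q q' := Icc_subset_Icc_right ht.2
      have h3 : ∫ s in q..t, G (σ (activeIndex τ s)) (Y s) = ∫ s in q..t, G i (w s) := by
        refine intervalIntegral.integral_congr_Ioo_of_le htq fun s hs => ?_
        rw [hconst s ⟨hs.1, hs.2.trans_le ht.2⟩, hYw (hsub (Ioo_subset_Icc_self hs))]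
      have h4 : ∫ s in q..t, G i (w s) = w t - w q := by
        refine intervalIntegral.integral_eq_sub_of_hasDerivAt_of_le htq (hwc.mono hsub)
          (fun s hs => (hw s (hsub (Ioo_subset_Icc_self hs))).hasDerivAt
            (Icc_mem_nhds hs.1 (hs.2.trans_le ht.2))) ?_
        refine ContinuousOn.intervalIntegrable ?_
        rw [uIcc_of_le htq]
        exact (hGc i).comp_continuousOn (hwc.mono hsub)
      rw [h3, h4, hYw ⟨htq, ht.2⟩, hYw ⟨le_rfl, hqq.le⟩]
      abel

theorem hasDerivAt_switched {G : Fin N → E → E} (hG : ∀ i, Continuous (G i))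
    {σ : Fin (K + 1) → Fin N} {τ : Fin K → ℝ} {T : ℝ} {x₀ : E} {y : ℝ → E}
    (hy : ContinuousOn y (Icc 0 T))
    (hyeq : ∀ t ∈ Icc 0 T, y t = x₀ + ∫ s in (0 : ℝ)..t, G (σ (activeIndex τ s)) (y s))
    {t : ℝ} (ht : t ∈ Ioo 0 T) (htτ : t ∉ range τ) :
    HasDerivAt y (G (σ (activeIndex τ t)) (y t)) t := by
  have hA := measurable_mode σ τ
  have hnhds : Icc 0 T ∈ 𝓝 t := Icc_mem_nhds ht.1 ht.2
  have hc : ContinuousAt (fun s => G (σ (activeIndex τ s)) (y s)) t := by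
    have h1 : ContinuousAt (fun s => G (σ (activeIndex τ t)) (y s)) t :=
      (hG _).continuousAt.comp (hy.continuousAt hnhds)
    refine h1.congr ?_
    filter_upwards [eventually_activeIndex_eq htτ] with s hs
    rw [hs]
  have hint := intervalIntegrable_switched hA hG (ht.1.le.trans ht.2.le) hy
  have hmeas : StronglyMeasurableAtFilter (fun s => G (σ (activeIndex τ s)) (y s)) (𝓝 t) :=
    ⟨Icc 0 T, hnhds, ((intervalIntegrable_iff_integrableOn_Icc_of_le
      (ht.1.le.trans ht.2.le)).1 hint).aestronglyMeasurable⟩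
  have := (intervalIntegral.integral_hasDerivAt_right
    (intervalIntegrable_switched hA hG ht.1.le (hy.mono (Icc_subset_Icc_right ht.2.le)))
    hmeas hc).const_add x₀
  refine this.congr_of_eventuallyEq ?_
  filter_upwards [hnhds] with s hs using hyeq s hs

end Switched

/-- The second order Taylor estimate for a bound on the second derivative. -/
theorem norm_sub_sub_fderiv_le {E F : Type*} [NormedAddCommGroup E] [NormedSpace ℝ E]
    [NormedAddCommGroup F] [NormedSpace ℝ F] {f : E → F} (hf : ContDiff ℝ 2 f) {C : ℝ}
    (hC : ∀ x, ‖iteratedFDeriv ℝ 2 f x‖ ≤ C) (x y : E) :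
    ‖f y - f x - fderiv ℝ f x (y - x)‖ ≤ C * ‖y - x‖ ^ 2 := by
  have hf1 : ContDiff ℝ 1 (fderiv ℝ f) := hf.fderiv_right (by norm_num)
  have hC0 : 0 ≤ C := (norm_nonneg _).trans (hC x)
  have hlip : ∀ w, ‖fderiv ℝ f w - fderiv ℝ f x‖ ≤ C * ‖w - x‖ := by
    intro w
    refine convex_univ.norm_image_sub_le_of_norm_fderiv_le (𝕜 := ℝ)
      (fun v _ => hf1.differentiable (by norm_num) v) (fun v _ => ?_) (mem_univ x) (mem_univ w)
    rw [← norm_iteratedFDeriv_one, norm_iteratedFDeriv_fderiv]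
    exact hC v
  -- On this ball `fderiv ℝ f` stays within `C * ‖y - x‖` of its value at `x`; the mean value
  -- inequality then gives the constant `C`, without the factor `1/2`.
  have := (convex_closedBall x ‖y - x‖).norm_image_sub_le_of_norm_fderiv_le' (𝕜 := ℝ) (f := f)
    (φ := fderiv ℝ f x) (C := C * ‖y - x‖) (x := x) (y := y)
    (fun v _ => hf.differentiable (by norm_num) v)
    (fun v hv => (hlip v).trans (mul_le_mul_of_nonneg_left (by
      simpa [dist_eq_norm] using hv) hC0))
    (by simp) (by simp [dist_eq_norm])
  rw [pow_two, ← mul_assoc]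
  exact this

/-- The modes agree on a given ball with bounded, Lipschitz vector fields. -/
theorem SwitchedSystem.exists_truncation {n N : ℕ} (sys : SwitchedSystem n N) {R : ℝ}
    (hR : 0 < R) : ∃ (G : Fin N → State n → State n) (Λ : NNReal) (M : ℝ),
      (∀ i, LipschitzWith Λ (G i)) ∧ (∀ i x, ‖G i x‖ ≤ M) ∧
        ∀ i x, ‖x‖ ≤ R → G i x = sys.f i x := by
  -- The modes may grow quadratically. A cutoff makes them compactly supported, hence globally
  -- bounded and Lipschitz.
  let χ : ContDiffBump (0 : State n) := ⟨R, R + 1, hR, by linarith⟩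
  let G : Fin N → State n → State n := fun i x => χ x • sys.f i x
  have hsupp : ∀ i, HasCompactSupport (G i) := fun i => χ.hasCompactSupport.smul_right
  have hcd : ∀ i, ContDiff ℝ 2 (G i) := fun i => χ.contDiff.smul (sys.f_contDiff i)
  choose Λ hΛ using fun i => (hcd i).lipschitzWith_of_hasCompactSupport (hsupp i) (by norm_num)
  choose M hM using fun i => (hsupp i).exists_bound_of_continuous (hcd i).continuous
  refine ⟨G, ∑ i, Λ i, ∑ i, |M i|, fun i => (hΛ i).weaken ?_, fun i x => ?_, fun i x hx => ?_⟩
  · exact Finset.single_le_sum (f := Λ) (fun _ _ => zero_le) (Finset.mem_univ i)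
  · exact ((hM i x).trans (le_abs_self _)).trans
      (Finset.single_le_sum (f := fun i => |M i|) (fun _ _ => abs_nonneg _) (Finset.mem_univ i))
  · have : χ x = 1 := χ.one_of_mem_closedBall (by simpa [χ] using hx)
    simp [G, this]

theorem intervalIntegral_indicator_const {t b : ℝ} {D : Set ℝ} (hD : MeasurableSet D)
    (ht : 0 ≤ t) :
    ∫ s in (0 : ℝ)..t, indicator D (fun _ => b) s = volume.real (D ∩ Icc 0 t) * b := by
  rw [intervalIntegral.integral_of_le ht, ← integral_Icc_eq_integral_Ioc,
    integral_indicator hD, setIntegral_const, smul_eq_mul,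
    measureReal_restrict_apply hD]

/-- A trajectory deviates from another one at most in proportion to the time during which their
modes differ. -/
theorem norm_switched_sub_le {N : ℕ} {E : Type*} [NormedAddCommGroup E] [NormedSpace ℝ E]
    [CompleteSpace E] {G : Fin N → E → E} {Λ : NNReal} {M : ℝ}
    (hG : ∀ i, LipschitzWith Λ (G i)) (hM : ∀ i x, ‖G i x‖ ≤ M) {A A' : ℝ → Fin N}
    (hA : Measurable A) (hA' : Measurable A') {T : ℝ} {x₀ : E} {x y : ℝ → E} (hM0 : 0 ≤ M)
    (hx : ContinuousOn x (Icc 0 T)) (hy : ContinuousOn y (Icc 0 T))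
    (hxeq : ∀ t ∈ Icc 0 T, x t = x₀ + ∫ s in (0 : ℝ)..t, G (A s) (x s))
    (hyeq : ∀ t ∈ Icc 0 T, y t = x₀ + ∫ s in (0 : ℝ)..t, G (A' s) (y s)) :
    ∀ t ∈ Icc 0 T, ‖y t - x t‖ ≤
      2 * M * Real.exp (Λ * T) * volume.real ({s | A' s ≠ A s} ∩ Icc 0 T) := by
  have hGc : ∀ i, Continuous (G i) := fun i => (hG i).continuous
  have hD : MeasurableSet {s | A' s ≠ A s} := (measurableSet_eq_fun hA' hA).compl
  set D := {s | A' s ≠ A s} with hDdef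
  have key := le_mul_exp_of_le_add_integral (φ := fun t => ‖y t - x t‖) (T := T)
    (δ := 2 * M * volume.real (D ∩ Icc 0 T)) (Λ := Λ) Λ.2 (hy.sub hx).norm (fun t ht => by
      have hsub : Icc 0 t ⊆ Icc 0 T := Icc_subset_Icc_right ht.2
      have hix := intervalIntegrable_switched hA hGc ht.1 (hx.mono hsub)
      have hiy := intervalIntegrable_switched hA' hGc ht.1 (hy.mono hsub)
      have hie : IntervalIntegrable (fun s => ‖y s - x s‖) volume 0 t :=
        ContinuousOn.intervalIntegrable (by
          rw [uIcc_of_le ht.1]; exact ((hy.sub hx).norm).mono hsub)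
      have hii : IntervalIntegrable (indicator D fun _ => 2 * M) volume 0 t := by
        rw [intervalIntegrable_iff_integrableOn_Icc_of_le ht.1]
        exact (integrableOn_const (by simp)).indicator hD
      have hpt : ∀ s ∈ Icc 0 t, ‖G (A' s) (y s) - G (A s) (x s)‖ ≤
          Λ * ‖y s - x s‖ + indicator D (fun _ => 2 * M) s := by
        intro s _
        by_cases hs : A' s = A s
        · have : s ∉ D := fun h => h hs
          rw [indicator_of_notMem this, add_zero, hs]
          exact (hG _).norm_sub_le _ _
        · rw [indicator_of_mem (show s ∈ D from hs)]
          have h1 := norm_sub_le (G (A' s) (y s)) (G (A s) (x s))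
          have h2 : 0 ≤ (Λ : ℝ) * ‖y s - x s‖ := by positivity
          linarith [hM (A' s) (y s), hM (A s) (x s)]
      have hvol : volume.real (D ∩ Icc 0 t) ≤ volume.real (D ∩ Icc 0 T) :=
        measureReal_mono (inter_subset_inter_right _ hsub)
          (measure_ne_top_of_subset inter_subset_right (by simp))
      calc ‖y t - x t‖
          = ‖∫ s in (0 : ℝ)..t, (G (A' s) (y s) - G (A s) (x s))‖ := by
            rw [hyeq t ht, hxeq t ht, intervalIntegral.integral_sub hiy hix]
            congr 1
            abel
        _ ≤ ∫ s in (0 : ℝ)..t, ‖G (A' s) (y s) - G (A s) (x s)‖ :=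
            intervalIntegral.norm_integral_le_integral_norm ht.1
        _ ≤ ∫ s in (0 : ℝ)..t, (Λ * ‖y s - x s‖ + indicator D (fun _ => 2 * M) s) :=
            intervalIntegral.integral_mono_on ht.1 (hiy.sub hix).norm
              ((hie.const_mul _).add hii) hpt
        _ = Λ * (∫ s in (0 : ℝ)..t, ‖y s - x s‖) + volume.real (D ∩ Icc 0 t) * (2 * M) := by
            rw [intervalIntegral.integral_add (hie.const_mul _) hii,
              intervalIntegral.integral_const_mul, intervalIntegral_indicator_const hD ht.1]
        _ ≤ _ := by nlinarith)
  intro t ht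
  refine (key t ht).trans ?_
  have hT : Real.exp (Λ * t) ≤ Real.exp (Λ * T) :=
    Real.exp_le_exp.2 (mul_le_mul_of_nonneg_left ht.2 Λ.2)
  have := mul_le_mul_of_nonneg_left hT
    (show 0 ≤ 2 * M * volume.real (D ∩ Icc 0 T) by positivity)
  linarith

/-! ### The cost of a briefly deviating schedule. -/

namespace Iterate

variable {n N : ℕ} {sys : SwitchedSystem n N} (z : Iterate sys)

/-- The active mode of the iterate. -/
def mode (t : ℝ) : Fin N := z.σ (activeIndex z.τ t)

theorem u_eq_single (t : ℝ) : z.u t = Pi.single (z.mode t) 1 := rfl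

theorem measurable_activeMode : Measurable z.mode := measurable_mode z.σ z.τ

theorem x_eq : ∀ t ∈ Icc 0 sys.T,
    z.x t = sys.x₀ + ∫ s in (0 : ℝ)..t, sys.f (z.mode s) (z.x s) := by
  intro t ht
  rw [z.feasible.2.2 t ht]
  congr 1
  refine intervalIntegral.integral_congr fun s _ => ?_
  exact sys.F_single _ _

/-- Schedules whose modes differ only briefly from those of the iterate have trajectories, which
remain near that of the iterate. -/
theorem exists_nearby_trajectory : ∃ C Λ δ : ℝ, 0 ≤ C ∧ 0 ≤ Λ ∧ 0 < δ ∧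
    ∀ {K' : ℕ} (σ' : Fin (K' + 1) → Fin N) (τ' : Fin K' → ℝ),
      volume.real ({s | σ' (activeIndex τ' s) ≠ z.mode s} ∩ Icc 0 sys.T) ≤ δ →
      ∃ x' : ℝ → State n, ContinuousOn x' (Icc 0 sys.T) ∧
        (∀ t ∈ Icc 0 sys.T,
          x' t = sys.x₀ + ∫ s in (0 : ℝ)..t, sys.f (σ' (activeIndex τ' s)) (x' s)) ∧
        ∀ t ∈ Icc 0 sys.T, (‖x' t - z.x t‖ ≤
            C * volume.real ({s | σ' (activeIndex τ' s) ≠ z.mode s} ∩ Icc 0 sys.T)) ∧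
          ∀ i, ‖sys.f i (x' t) - sys.f i (z.x t)‖ ≤ Λ * ‖x' t - z.x t‖ := by
  obtain ⟨X, hX⟩ := isCompact_Icc.exists_bound_of_continuousOn z.feasible.2.1
  have hX0 : 0 ≤ X := (norm_nonneg _).trans (hX 0 ⟨le_rfl, sys.T_pos.le⟩)
  obtain ⟨G, Λ, M, hG, hM, hGf⟩ := sys.exists_truncation (R := X + 1) (by linarith)
  have hM0 : 0 ≤ M := (norm_nonneg _).trans (hM (z.σ 0) 0)
  set C : ℝ := 2 * M * Real.exp (Λ * sys.T) with hC
  have hC0 : 0 ≤ C := by positivity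
  -- A deviation time of at most `1 / (C + 1)` keeps the truncated solution within `1` of `z.x`,
  -- hence in the ball of radius `X + 1`, where it solves the original equation.
  refine ⟨C, Λ, 1 / (C + 1), hC0, Λ.2, by positivity, fun σ' τ' hδ => ?_⟩
  obtain ⟨y, hy, hyeq⟩ := exists_switched_solution hG hM σ' τ' sys.T_pos.le sys.x₀
  have hxG : ∀ t ∈ Icc 0 sys.T, ∀ i, G i (z.x t) = sys.f i (z.x t) := fun t ht i =>
    hGf i _ (by linarith [hX t ht])
  have hbound := norm_switched_sub_le hG hM z.measurable_activeMode (measurable_mode σ' τ')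
    (x₀ := sys.x₀) hM0 z.feasible.2.1 hy (fun t ht => by
      rw [z.x_eq t ht]
      congr 1
      refine intervalIntegral.integral_congr fun s hs => ?_
      rw [uIcc_of_le ht.1] at hs
      exact (hxG s ⟨hs.1, hs.2.trans ht.2⟩ _).symm) hyeq
  have hyG : ∀ t ∈ Icc 0 sys.T, ∀ i, G i (y t) = sys.f i (y t) := by
    intro t ht i
    refine hGf i _ ?_
    have h1 : C * (1 / (C + 1)) ≤ 1 := by
      rw [mul_one_div, div_le_one (by linarith)]
      linarith
    have h2 := (hbound t ht).trans (mul_le_mul_of_nonneg_left hδ hC0)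
    have h3 := norm_add_le (y t - z.x t) (z.x t)
    rw [sub_add_cancel] at h3
    linarith [hX t ht]
  refine ⟨y, hy, fun t ht => ?_, fun t ht => ⟨hbound t ht, fun i => ?_⟩⟩
  · rw [hyeq t ht]
    congr 1
    refine intervalIntegral.integral_congr fun s hs => ?_
    rw [uIcc_of_le ht.1] at hs
    exact hyG s ⟨hs.1, hs.2.trans ht.2⟩ _
  · rw [← hyG t ht, ← hxG t ht]
    exact (hG i).norm_sub_le _ _

/-- The integrand of the cost difference that is obtained by adding the derivative of
`ρᵀ (x' - x)`. -/
def costIntegrand (A' : ℝ → Fin N) (x' : ℝ → State n) (t : ℝ) : ℝ :=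
  (sys.ℓ (x' t) - sys.ℓ (z.x t) - fderiv ℝ sys.ℓ (z.x t) (x' t - z.x t)) +
    inner ℝ (z.ρ t) (sys.f (A' t) (x' t) - sys.f (z.mode t) (z.x t)
      - fderiv ℝ (sys.f (z.mode t)) (z.x t) (x' t - z.x t))

theorem continuousOn_fderiv_apply {F : Type*} [NormedAddCommGroup F] [NormedSpace ℝ F]
    {f : State n → F} (hf : ContDiff ℝ 2 f) {x h : ℝ → State n} {s : Set ℝ}
    (hx : ContinuousOn x s) (hh : ContinuousOn h s) :
    ContinuousOn (fun t => fderiv ℝ f (x t) (h t)) s :=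
  ((hf.continuous_fderiv (by norm_num)).comp_continuousOn hx).clm_apply hh

/-- `ρᵀ(x' - x)` vanishes at `0` by the common initial state and at `T` because `ρ(T) = 0`. Its
derivative, computed from the adjoint equation off the finitely many switching times, can thus be
added at no cost; it cancels the first order terms. -/
theorem cost_sub_eq {K' : ℕ} {σ' : Fin (K' + 1) → Fin N} {τ' : Fin K' → ℝ} {x' : ℝ → State n}
    (hx' : ContinuousOn x' (Icc 0 sys.T))
    (hx'eq : ∀ t ∈ Icc 0 sys.T,
      x' t = sys.x₀ + ∫ s in (0 : ℝ)..t, sys.f (σ' (activeIndex τ' s)) (x' s)) :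
    IntervalIntegrable (z.costIntegrand (fun t => σ' (activeIndex τ' t)) x') volume 0 sys.T ∧
    sys.cost x' - sys.cost z.x =
      ∫ t in (0 : ℝ)..sys.T, z.costIntegrand (fun t => σ' (activeIndex τ' t)) x' t := by
  set A' : ℝ → Fin N := fun t => σ' (activeIndex τ' t) with hA'
  have hT := sys.T_pos.le
  have hx := z.feasible.2.1
  have hρ := z.ρ_continuousOn
  have hfc : ∀ i, Continuous (sys.f i) := fun i => (sys.f_contDiff i).continuous
  have hy : ContinuousOn (fun t => x' t - z.x t) (Icc 0 sys.T) := hx'.sub hx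
  let φ' : ℝ → ℝ := fun t => -fderiv ℝ sys.ℓ (z.x t) (x' t - z.x t) +
    inner ℝ (z.ρ t) (sys.f (A' t) (x' t) - sys.f (z.mode t) (z.x t)
      - fderiv ℝ (sys.f (z.mode t)) (z.x t) (x' t - z.x t))
  have hder : ∀ t ∈ Ioo 0 sys.T \ (range z.τ ∪ range τ'),
      HasDerivAt (fun t => inner ℝ (z.ρ t) (x' t - z.x t)) (φ' t) t := by
    rintro t ⟨ht, hn⟩
    have h1 := z.ρ_deriv t ht fun h => hn (Or.inl h)
    have h2 := hasDerivAt_switched hfc hx' hx'eq ht fun h => hn (Or.inr h)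
    have h3 := hasDerivAt_switched (σ := z.σ) (τ := z.τ) hfc hx z.x_eq ht fun h => hn (Or.inl h)
    refine (h1.inner ℝ (h2.sub h3)).congr_deriv ?_
    simp only [φ', hA', mode, Pi.sub_apply, inner_sub_right, inner_sub_left, inner_neg_left,
      ContinuousLinearMap.adjoint_inner_left, gradient, InnerProductSpace.toDual_symm_apply,
      map_sub]
    ring
  have hφc : ContinuousOn (fun t => inner ℝ (z.ρ t) (x' t - z.x t)) (Icc 0 sys.T) := hρ.inner hy
  have hφ'int : IntervalIntegrable φ' volume 0 sys.T := by
    rw [intervalIntegrable_iff_integrableOn_Icc_of_le hT]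
    have hm : Measurable fun t => (A' t, z.mode t) :=
      (measurable_mode σ' τ').prodMk z.measurable_activeMode
    exact integrableOn_switched hm (g := fun i t => -fderiv ℝ sys.ℓ (z.x t) (x' t - z.x t) +
      inner ℝ (z.ρ t) (sys.f i.1 (x' t) - sys.f i.2 (z.x t)
        - fderiv ℝ (sys.f i.2) (z.x t) (x' t - z.x t))) fun i =>
      (continuousOn_fderiv_apply sys.ℓ_contDiff hx hy).neg.add
        (hρ.inner ((((hfc _).comp_continuousOn hx').sub ((hfc _).comp_continuousOn hx)).sub
          (continuousOn_fderiv_apply (sys.f_contDiff _) hx hy)))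
  have hzero : ∫ t in (0 : ℝ)..sys.T, φ' t = 0 := by
    rw [integral_eq_of_hasDerivAt_off_countable_of_le _ φ' hT
      ((finite_range z.τ).union (finite_range τ')).countable hφc hder hφ'int, z.ρ_final,
      z.x_eq 0 ⟨le_rfl, hT⟩, hx'eq 0 ⟨le_rfl, hT⟩]
    simp
  have hℓ' : IntervalIntegrable (fun t => sys.ℓ (x' t)) volume 0 sys.T := by
    refine ContinuousOn.intervalIntegrable ?_
    rw [uIcc_of_le hT]
    exact sys.ℓ_contDiff.continuous.comp_continuousOn hx'
  have hℓ : IntervalIntegrable (fun t => sys.ℓ (z.x t)) volume 0 sys.T := by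
    refine ContinuousOn.intervalIntegrable ?_
    rw [uIcc_of_le hT]
    exact sys.ℓ_contDiff.continuous.comp_continuousOn hx
  have hsum : z.costIntegrand A' x' = fun t => (sys.ℓ (x' t) - sys.ℓ (z.x t)) + φ' t := by
    funext t
    simp only [costIntegrand, φ']
    ring
  rw [hsum]
  refine ⟨(hℓ'.sub hℓ).add hφ'int, ?_⟩
  rw [intervalIntegral.integral_add (hℓ'.sub hℓ) hφ'int, hzero, add_zero,
    intervalIntegral.integral_sub hℓ' hℓ]
  rfl

/-- Deviating from the active modes for a short time decreases the cost in proportion to the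
mode insertion gradient. -/
theorem exists_cost_sub_le : ∃ C δ : ℝ, 0 ≤ C ∧ 0 < δ ∧
    ∀ {K' : ℕ} (σ' : Fin (K' + 1) → Fin N) (τ' : Fin K' → ℝ) (Δ : ℝ),
      volume.real ({s | σ' (activeIndex τ' s) ≠ z.mode s} ∩ Icc 0 sys.T) = Δ → Δ ≤ δ →
      ∃ x' : ℝ → State n, ContinuousOn x' (Icc 0 sys.T) ∧
        (∀ t ∈ Icc 0 sys.T,
          x' t = sys.x₀ + ∫ s in (0 : ℝ)..t, sys.f (σ' (activeIndex τ' s)) (x' s)) ∧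
        ∀ κ : ℝ, (∀ᵐ t, t ∈ Icc 0 sys.T → σ' (activeIndex τ' t) ≠ z.mode t →
            z.d (σ' (activeIndex τ' t)) t ≤ -κ) →
          sys.cost x' - sys.cost z.x ≤ -κ * Δ + C * Δ ^ 2 := by
  obtain ⟨C, Λ, δ, hC, hΛ, hδ, hex⟩ := z.exists_nearby_trajectory
  obtain ⟨P, hP⟩ := isCompact_Icc.exists_bound_of_continuousOn z.ρ_continuousOn
  have hP0 : 0 ≤ P := (norm_nonneg _).trans (hP 0 ⟨le_rfl, sys.T_pos.le⟩)
  obtain ⟨Kf, hKf0, hKf⟩ := sys.f_bound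
  obtain ⟨Kl, hKl0, hKl⟩ := sys.ℓ_bound
  have hT := sys.T_pos
  -- The first summand collects the Taylor remainders over all of `[0,T]`. The second is the change
  -- of the two modes between `x` and `x'`, of order `Δ`, during a time `Δ`.
  refine ⟨sys.T * ((Kl + P * Kf) * C ^ 2) + 2 * P * Λ * C, δ, by positivity, hδ,
    fun σ' τ' Δ hΔ hle => ?_⟩
  obtain ⟨x', hx', hx'eq, hnear⟩ := hex σ' τ' (hΔ.trans_le hle)
  rw [hΔ] at hnear
  refine ⟨x', hx', hx'eq, fun κ hκ => ?_⟩
  obtain ⟨hint, heq⟩ := z.cost_sub_eq hx' hx'eq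
  have hΔ0 : 0 ≤ Δ := hΔ ▸ measureReal_nonneg
  have hD : MeasurableSet {s | σ' (activeIndex τ' s) ≠ z.mode s} :=
    (measurableSet_eq_fun (measurable_mode σ' τ') z.measurable_activeMode).compl
  set D := {s | σ' (activeIndex τ' s) ≠ z.mode s} with hDdef
  set a := (Kl + P * Kf) * (C * Δ) ^ 2 with ha
  set b := -κ + 2 * P * Λ * (C * Δ) with hb
  have hpt : ∀ᵐ t, t ∈ Icc 0 sys.T → z.costIntegrand (fun t => σ' (activeIndex τ' t)) x' t ≤
      a + indicator D (fun _ => b) t := by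
    filter_upwards [hκ] with t ht htI
    obtain ⟨h1, h2⟩ := hnear t htI
    set e := ‖x' t - z.x t‖ with he
    have he0 : 0 ≤ e := norm_nonneg _
    have hesq : e ^ 2 ≤ (C * Δ) ^ 2 := pow_le_pow_left₀ he0 h1 2
    have hℓ := (le_abs_self _).trans (norm_sub_sub_fderiv_le sys.ℓ_contDiff hKl (z.x t) (x' t))
    have hinner : ∀ v : State n, inner ℝ (z.ρ t) v ≤ P * ‖v‖ := fun v =>
      (real_inner_le_norm _ _).trans (mul_le_mul_of_nonneg_right (hP t htI) (norm_nonneg _))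
    have hf := norm_sub_sub_fderiv_le (sys.f_contDiff (z.mode t)) (hKf (z.mode t))
      (z.x t) (x' t)
    have hPe : (Kl + P * Kf) * e ^ 2 ≤ a := mul_le_mul_of_nonneg_left hesq (by positivity)
    have hPf := mul_le_mul_of_nonneg_left hf hP0
    by_cases hA : σ' (activeIndex τ' t) = z.mode t
    · rw [indicator_of_notMem (show t ∉ D from fun h => h hA), add_zero]
      simp only [costIntegrand, hA]
      have := hinner (sys.f (z.mode t) (x' t) - sys.f (z.mode t) (z.x t)
        - fderiv ℝ (sys.f (z.mode t)) (z.x t) (x' t - z.x t))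
      linarith
    · rw [indicator_of_mem (show t ∈ D from hA)]
      have hd := ht htI hA
      rw [z.d_of_u (z.u_eq_single t)] at hd
      simp only [costIntegrand]
      set i := σ' (activeIndex τ' t)
      set j := z.mode t
      have hsplit : sys.f i (x' t) - sys.f j (z.x t) - fderiv ℝ (sys.f j) (z.x t) (x' t - z.x t) =
          (sys.f i (z.x t) - sys.f j (z.x t)) + (sys.f i (x' t) - sys.f i (z.x t)) +
          (-(sys.f j (x' t) - sys.f j (z.x t))) +
          (sys.f j (x' t) - sys.f j (z.x t) - fderiv ℝ (sys.f j) (z.x t) (x' t - z.x t)) := by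
        abel
      rw [hsplit, inner_add_right, inner_add_right, inner_add_right]
      have g1 := (hinner _).trans (mul_le_mul_of_nonneg_left (h2 i) hP0)
      have g2 := (hinner (-(sys.f j (x' t) - sys.f j (z.x t)))).trans
        (mul_le_mul_of_nonneg_left ((norm_neg _).trans_le (h2 j)) hP0)
      have g3 := hinner (sys.f j (x' t) - sys.f j (z.x t)
        - fderiv ℝ (sys.f j) (z.x t) (x' t - z.x t))
      have g4 : P * Λ * e ≤ P * Λ * (C * Δ) := mul_le_mul_of_nonneg_left h1 (by positivity)
      linarith
  have hbd : IntervalIntegrable (fun t => a + indicator D (fun _ => b) t) volume 0 sys.T := by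
    rw [intervalIntegrable_iff_integrableOn_Icc_of_le hT.le]
    exact (integrableOn_const (by simp)).add ((integrableOn_const (by simp)).indicator hD)
  have hind : IntervalIntegrable (indicator D fun _ => b) volume 0 sys.T := by
    rw [intervalIntegrable_iff_integrableOn_Icc_of_le hT.le]
    exact (integrableOn_const (by simp)).indicator hD
  calc sys.cost x' - sys.cost z.x
      = ∫ t in (0 : ℝ)..sys.T, z.costIntegrand (fun t => σ' (activeIndex τ' t)) x' t := heq
    _ ≤ ∫ t in (0 : ℝ)..sys.T, (a + indicator D (fun _ => b) t) :=
        intervalIntegral.integral_mono_ae_restrict hT.le hint hbd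
          ((ae_restrict_iff' measurableSet_Icc).2 hpt)
    _ = sys.T * a + Δ * b := by
        rw [intervalIntegral.integral_add (by simp) hind, intervalIntegral_indicator_const hD hT.le,
          intervalIntegral.integral_const, hΔ]
        simp
    _ = _ := by rw [ha, hb]; ring

end Iterate

/-! ### Displacement rates, sufficient descent and backtracking. -/

namespace Iterate

variable {n N : ℕ} {sys : SwitchedSystem n N} {z : Iterate sys}

namespace InitialSchedule

variable (S : z.InitialSchedule)

/-- A switching time of type 2 moves at the rate of a square root. -/
theorem tendsto_displacement (hθ : z.θ < 0) {i : Fin S.K} {c b₂ : ℝ} (hb₂ : 0 < b₂)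
    (hk : z.SwitchKind (S.σ i.castSucc) (S.σ i.succ) (fun γ => S.τ γ i) c) (hi : S.HasType i 2)
    (hpos : ∀ᶠ γ in 𝓝[>] z.γ₀, b₂ < S.secondDeriv i γ) :
    0 < limUnder (𝓝[>] z.γ₀) (S.secondDeriv i) ∧
      Tendsto (fun γ => |S.τ γ i - c| / √(γ - z.γ₀)) (𝓝[>] z.γ₀)
        (𝓝 (√2 * |z.θ| / √(limUnder (𝓝[>] z.γ₀) (S.secondDeriv i)))) := by
  obtain ⟨hnf, h1, v, -, h2⟩ : ¬ S.Frozen i ∧ (∀ l, 1 ≤ l → l ≤ 1 → S.DerivAtPlus i l 0) ∧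
    ∃ v, v ≠ 0 ∧ S.DerivAtPlus i 2 v := hi
  have h1 := h1 1 le_rfl le_rfl
  unfold DerivAtPlus at h1 h2
  have htwo : ∀ f : ℝ → ℝ, iteratedDeriv 2 f = deriv (deriv f) := fun f => by
    rw [iteratedDeriv_succ, iteratedDeriv_one]
  rw [iteratedDeriv_one] at h1
  rw [htwo] at h2
  have conclude : ∀ v, Tendsto (S.secondDeriv i) (𝓝[>] z.γ₀) (𝓝 v) →
      (0 < v → Tendsto (fun γ => |S.τ γ i - c| / √(γ - z.γ₀)) (𝓝[>] z.γ₀)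
        (𝓝 (√2 * |z.θ| / √v))) →
      0 < limUnder (𝓝[>] z.γ₀) (S.secondDeriv i) ∧
      Tendsto (fun γ => |S.τ γ i - c| / √(γ - z.γ₀)) (𝓝[>] z.γ₀)
        (𝓝 (√2 * |z.θ| / √(limUnder (𝓝[>] z.γ₀) (S.secondDeriv i)))) := by
    intro v hv h
    have hv0 : 0 < v := hb₂.trans_le (ge_of_tendsto hv (hpos.mono fun γ h => h.le))
    rw [hv.limUnder_eq]
    exact ⟨hv0, h hv0⟩
  rcases hk with hk | ⟨c', hlt, hcont, hmono, hc, hinfo, hh, hlim⟩ |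
    ⟨c', hlt, hcont, hanti, hc, hinfo, hh, hlim⟩
  · exact absurd ⟨c, hk⟩ hnf
  · have hmove : S.movingMode i = S.σ i.castSucc :=
      if_pos ⟨c, hlim, hh.mono fun γ h => h.1.1⟩
    refine conclude v (h2.congr' ?_) fun hv =>
      level_right_asymptotics hθ hlt hcont hmono hc (fun t ht => (hinfo t ht).1) hh hlim hv h1 h2
    filter_upwards [hh] with γ hγ
    rw [secondDeriv, hmove, ← htwo]
    refine (Filter.EventuallyEq.iteratedDeriv_eq 2 ?_).symm
    -- The switching time is interior to a cell, where `d_a` and `d_{as}` agree as functions, hence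
    -- so do their second derivatives.
    filter_upwards [Ioo_mem_nhds hγ.1.1 hγ.1.2] with t ht using (hinfo t ht).2
  · have hmove : S.movingMode i = S.σ i.succ := by
      refine if_neg ?_
      rintro ⟨c'', hlim', hlt'⟩
      obtain rfl := tendsto_nhds_unique hlim hlim'
      obtain ⟨γ, hγ, hγ'⟩ := (hlt'.and hh).exists
      exact lt_asymm hγ hγ'.1.2
    -- Here the inserted mode follows the switching time, so the type is defined through the
    -- negative of the function whose level is tracked.
    have hneg : z.dDiff (S.σ i.castSucc) (S.σ i.succ) =
        fun t => -z.dDiff (S.σ i.succ) (S.σ i.castSucc) t := by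
      funext t
      simp only [dDiff]
      ring
    have hneg1 : deriv (fun t => -z.dDiff (S.σ i.succ) (S.σ i.castSucc) t) =
        fun t => -deriv (z.dDiff (S.σ i.succ) (S.σ i.castSucc)) t := funext fun t => deriv.fun_neg
    have hneg2 : deriv (fun t => -deriv (z.dDiff (S.σ i.succ) (S.σ i.castSucc)) t) =
        fun t => -deriv (deriv (z.dDiff (S.σ i.succ) (S.σ i.castSucc))) t :=
      funext fun t => deriv.fun_neg
    rw [hneg, hneg1] at h1 h2
    rw [hneg2] at h2
    have h1' := h1.neg
    have h2' := h2.neg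
    simp only [neg_neg, neg_zero] at h1' h2'
    refine conclude (-v) (h2'.congr' ?_) fun hv =>
      level_left_asymptotics hθ hlt hcont hanti hc (fun t ht => (hinfo t ht).1) hh hlim hv h1' h2'
    filter_upwards [hh] with γ hγ
    rw [secondDeriv, hmove, ← htwo]
    refine (Filter.EventuallyEq.iteratedDeriv_eq 2 ?_).symm
    filter_upwards [Ioo_mem_nhds hγ.1.1 hγ.1.2] with t ht using (hinfo t ht).2

/-- The modes of `Q(u - γ d)` differ from the active modes when the control deviates. -/
theorem volume_mode_ne {γ : ℝ} {K : ℕ} {σ : Fin (K + 1) → Fin N} {τ : Fin K → ℝ}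
    (h : ∀ᵐ t, t ∈ Icc 0 sys.T → maxMapping (z.μ γ t) = scheduleControl σ τ t) :
    volume.real ({s | σ (activeIndex τ s) ≠ z.mode s} ∩ Icc 0 sys.T) =
      z.deviationTime sys.T γ := by
  refine measureReal_congr ?_
  have hI : Ioo 0 sys.T =ᵐ[volume] Icc 0 sys.T := Ioo_ae_eq_Icc
  filter_upwards [h, hI.mem_iff] with t ht hI
  refine propext ?_
  constructor
  · rintro ⟨hne, htI⟩
    refine ⟨?_, hI.2 htI⟩
    rw [deviation, mem_ofPred_eq, ht htI, z.u_eq_single]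
    exact single_one_ne hne
  · rintro ⟨hne, htI⟩
    refine ⟨fun heq => hne ?_, hI.1 htI⟩
    rw [ht (hI.1 htI), z.u_eq_single, ← heq]
    rfl

/-- If `Q` selects an inactive `a`, then `-γ d_a ≥ 1`, so the insertion gradient is at most `-1/γ`
wherever the control deviates. -/
theorem exists_maxProjection_cost_le : ∃ C δ : ℝ, 0 ≤ C ∧ 0 < δ ∧
    ∀ {γ : ℝ} {K : ℕ} {σ : Fin (K + 1) → Fin N} {τ : Fin K → ℝ}, 0 < γ →
      IsScheduleOf sys.T σ τ (fun t => maxMapping (z.μ γ t)) → z.deviationTime sys.T γ ≤ δ →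
      ∃ x' u', sys.IsMaxProjection (z.μ γ) x' u' ∧ sys.cost x' - sys.cost z.x ≤
        -(1 / γ) * z.deviationTime sys.T γ + C * z.deviationTime sys.T γ ^ 2 := by
  obtain ⟨C, δ, hC, hδ, h⟩ := z.exists_cost_sub_le
  refine ⟨C, δ, hC, hδ, fun {γ K σ τ} hγ hs hle => ?_⟩
  have hae := (ae_restrict_iff' measurableSet_Icc).1 hs.2
  obtain ⟨x', hx', hx'eq, hcost⟩ := h σ τ _ (volume_mode_ne hae) hle
  refine ⟨x', fun t => maxMapping (z.μ γ t), ⟨fun t => rfl,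
    ⟨fun t _ i => maxMapping_eq_zero_or_one _ i, K, σ, τ, hs⟩, hx', fun t ht => ?_⟩,
    hcost (1 / γ) ?_⟩
  · rw [hx'eq t ht]
    congr 1
    refine intervalIntegral.integral_congr_ae ?_
    filter_upwards [hae] with s hs hsI
    rw [uIoc_of_le ht.1] at hsI
    rw [hs ⟨hsI.1.le, hsI.2.trans ht.2⟩]
    exact (sys.F_single _ _).symm
  · filter_upwards [hae] with t ht htI hne
    have := le_of_maxMapping_eq_single (ht htI) (z.mode t)
    simp only [μ, z.u_eq_single, Pi.single_eq_same, Pi.single_eq_of_ne hne,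
      z.d_active (z.u_eq_single t)] at this
    rw [← neg_div, le_div_iff₀ hγ]
    linarith

theorem s₂_neg (hθ : z.θ < 0) (hT : S.GreatestType 2)
    (hv : ∀ i ∈ S.I₂, 0 < limUnder (𝓝[>] z.γ₀) (S.secondDeriv i)) : S.s₂ < 0 := by
  obtain ⟨i, hi⟩ := hT.1
  refine neg_neg_of_pos (Finset.sum_pos (fun i hi => ?_) ⟨i, by simp [I₂, hi]⟩)
  have := Real.sqrt_pos.2 (hv i hi)
  have := hθ.ne
  positivity

/-- The cost bound reads `-(1/γ - CΔ) Δ`, with a factor `1/γ - CΔ → -θ > 0`. So `Δ` may be replaced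
by the smaller sum of type 2 displacements, whose rate is known. -/
theorem eventually_sufficientDescent (hcrit : z.FinitelyManyCriticalPoints) (hθ : z.θ < 0)
    (hT : S.GreatestType 2) {α b₂ : ℝ} (hα : α < 1) (hb₂ : 0 < b₂)
    (hI : ∀ i ∈ S.I₂, ∀ᶠ γ in 𝓝[>] z.γ₀, b₂ < S.secondDeriv i γ) :
    ∀ᶠ γ in 𝓝[>] z.γ₀, S.SufficientDescent α γ := by
  obtain ⟨c, hkind, hsum⟩ := S.exists_switchKind hcrit hθ
  have hdisp := fun i (hi : i ∈ S.I₂) =>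
    S.tendsto_displacement hθ hb₂ (hkind i) (by simpa [I₂] using hi) (hI i hi)
  have hs₂ := S.s₂_neg hθ hT fun i hi => (hdisp i hi).1
  obtain ⟨C, δ, hC, hδ, hex⟩ := exists_maxProjection_cost_le (z := z)
  have hΔ := (hcrit.scheduledUpTo hθ).2
  have hγ₀ := z.γ₀_pos hθ
  have hW := tendsto_finsetSum S.I₂ fun i hi => (hdisp i hi).2
  have hrate : Tendsto (fun γ => 1 / γ - C * z.deviationTime sys.T γ) (𝓝[>] z.γ₀) (𝓝 (-z.θ)) := by
    have h1 : Tendsto (fun γ : ℝ => 1 / γ) (𝓝[>] z.γ₀) (𝓝 (1 / z.γ₀)) :=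
      (tendsto_const_nhds.div tendsto_id hγ₀.ne').mono_left nhdsWithin_le_nhds
    have h2 := h1.sub (hΔ.const_mul C)
    have h3 : 1 / z.γ₀ - C * 0 = -z.θ := by
      rw [γ₀, mul_zero, sub_zero, one_div_div, div_neg, div_one]
    rwa [h3] at h2
  have hlim := hrate.mul hW
  have hval : -z.θ * ∑ i ∈ S.I₂, √2 * |z.θ| / √(limUnder (𝓝[>] z.γ₀) (S.secondDeriv i)) =
      -S.s₂ := by
    rw [s₂, neg_neg, Finset.mul_sum]
    refine Finset.sum_congr rfl fun i _ => ?_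
    rw [abs_of_neg hθ]
    ring
  rw [hval] at hlim
  -- The strict gap between `α s₂` and `s₂` absorbs all lower order errors.
  have hgt : -(α * S.s₂) < -S.s₂ := by nlinarith
  filter_upwards [hlim.eventually (Ioi_mem_nhds hgt), hrate.eventually (Ioi_mem_nhds (neg_pos.2 hθ)),
    hΔ.eventually (Iio_mem_nhds hδ), S.isScheduleOf, hsum, self_mem_nhdsWithin]
    with γ hmain hpos hle hs hsum hγ
  simp only [mem_Ioi] at hmain hpos hle hγ
  obtain ⟨x', u', hproj, hcost⟩ := hex (hγ₀.trans hγ) hs hle.le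
  refine ⟨x', u', hproj, ?_⟩
  have hr : 0 < √(γ - z.γ₀) := Real.sqrt_pos.2 (sub_pos.2 hγ)
  set r := √(γ - z.γ₀)
  have h1 : (∑ i ∈ S.I₂, |S.τ γ i - c i| / r) * r ≤ z.deviationTime sys.T γ := by
    rw [← Finset.sum_div, div_mul_cancel₀ _ hr.ne']
    exact (Finset.sum_le_sum_of_subset_of_nonneg (Finset.subset_univ _)
      fun i _ _ => abs_nonneg _).trans hsum
  have h2 := mul_le_mul_of_nonneg_left h1 hpos.le
  have h3 := mul_lt_mul_of_pos_right hmain hr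
  linarith

end InitialSchedule

/-- The claim amounts to the cube root being less than `3`. Backtracking needs nothing else about
the value of `γ₃`. -/
theorem γ₀_lt_γ₃ (hθ : z.θ < 0) {α : ℝ} (hα : α ∈ Ioo (0 : ℝ) 1) : z.γ₀ < z.γ₃ α := by
  have hsqrt : √2 < 2 := by
    rw [Real.sqrt_lt' (by norm_num)]
    norm_num
  have hlt : (α * (3 * √2 / 2)) ^ (1 / 3 : ℝ) < 3 := by
    have h27 : (27 : ℝ) ^ (1 / 3 : ℝ) = 3 := by
      rw [show (27 : ℝ) = 3 ^ (3 : ℝ) by norm_num, ← Real.rpow_mul (by norm_num)]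
      norm_num
    have hα0 := hα.1
    refine (Real.rpow_lt_rpow (by positivity) ?_ (by norm_num)).trans_eq h27
    have h3 : 3 * √2 / 2 < 3 := by linarith
    have := mul_le_of_le_one_left (show 0 ≤ 3 * √2 / 2 by positivity) hα.2.le
    linarith
  unfold γ₃
  have := z.γ₀_pos hθ
  nlinarith

end Iterate

theorem mainTheorem5 {n N : ℕ} (sys : SwitchedSystem n N) (z : Iterate sys)
    (hcrit : z.FinitelyManyCriticalPoints)
    (α β : ℝ) (hα : α ∈ Set.Ioo (0 : ℝ) 1) (hβ : β ∈ Set.Ioo (0 : ℝ) 1)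
    (b₁ b₂ : ℝ) (hb₁ : 0 < b₁) (hb₂ : 0 < b₂) (hθ : z.θ < -b₁) :
    Nonempty z.InitialSchedule ∧
    ∀ S : z.InitialSchedule, S.GreatestType 2 →
      (∀ i ∈ S.I₂, ∀ᶠ γ in 𝓝[>] z.γ₀, b₂ < S.secondDeriv i γ) →
        -- the backtracking index is finite
        (∃ j : ℕ, IsLeast (S.acceptedSteps α β) j) ∧
        -- all steps within some distance `b₃ > 0` of `γ₀` give sufficient descent
        (∃ b₃ : ℝ, 0 < b₃ ∧ b₃ ≤ z.γ₃ α - z.γ₀ ∧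
          ∀ γ ∈ Set.Ioc z.γ₀ (z.γ₀ + b₃), S.SufficientDescent α γ) ∧
        -- every such `b₃` bounds the backtracking index
        ∀ b₃ : ℝ, 0 < b₃ → b₃ ≤ z.γ₃ α - z.γ₀ →
          (∀ γ ∈ Set.Ioc z.γ₀ (z.γ₀ + b₃), S.SufficientDescent α γ) →
          ∀ j : ℕ, IsLeast (S.acceptedSteps α β) j →
            (j : ℤ) ≤ ⌈Real.logb β (b₃ / (z.γ₃ α - z.γ₀))⌉ := by
  have hθ0 : z.θ < 0 := by linarith
  refine ⟨Iterate.nonempty_initialSchedule hcrit hθ0, fun S hS hI => ?_⟩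
  have hgap : 0 < z.γ₃ α - z.γ₀ := sub_pos.2 (Iterate.γ₀_lt_γ₃ hθ0 hα)
  have hstep : ∀ b₃ : ℝ, 0 < b₃ → (∀ γ ∈ Set.Ioc z.γ₀ (z.γ₀ + b₃), S.SufficientDescent α γ) →
      ∀ j : ℕ, β ^ j ≤ b₃ / (z.γ₃ α - z.γ₀) → j ∈ S.acceptedSteps α β := by
    intro b₃ _ hdesc j hj
    rw [le_div_iff₀ hgap] at hj
    have : 0 < (z.γ₃ α - z.γ₀) * β ^ j := mul_pos hgap (pow_pos hβ.1 j)
    refine hdesc _ ⟨?_, ?_⟩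
    · rw [Iterate.γStep]
      linarith
    · rw [Iterate.γStep]
      linarith
  have hb₃ : ∃ b₃ : ℝ, 0 < b₃ ∧ b₃ ≤ z.γ₃ α - z.γ₀ ∧
      ∀ γ ∈ Set.Ioc z.γ₀ (z.γ₀ + b₃), S.SufficientDescent α γ := by
    obtain ⟨r, hr, hsub⟩ := mem_nhdsGT_iff_exists_Ioc_subset.1
      (S.eventually_sufficientDescent hcrit hθ0 hS hα.2 hb₂ hI)
    refine ⟨min (r - z.γ₀) (z.γ₃ α - z.γ₀), lt_min (sub_pos.2 hr) hgap, min_le_right _ _,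
      fun γ hγ => hsub ⟨hγ.1, ?_⟩⟩
    have := min_le_left (r - z.γ₀) (z.γ₃ α - z.γ₀)
    linarith [hγ.2]
  refine ⟨?_, hb₃, ?_⟩
  · classical
    obtain ⟨b₃, h0, -, hdesc⟩ := hb₃
    obtain ⟨j, hj⟩ := exists_pow_lt_of_lt_one (div_pos h0 hgap) hβ.2
    have hex : ∃ j, j ∈ S.acceptedSteps α β := ⟨j, hstep b₃ h0 hdesc j hj.le⟩
    exact ⟨Nat.find hex, Nat.find_spec hex, fun k hk => Nat.find_min' hex hk⟩
  · intro b₃ h0 hle hdesc j hj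
    set ratio := b₃ / (z.γ₃ α - z.γ₀) with hratio
    have hr0 : 0 < ratio := div_pos h0 hgap
    have hr1 : ratio ≤ 1 := (div_le_one hgap).2 hle
    have hlog : 0 ≤ Real.logb β ratio :=
      (Real.logb_nonneg_iff_of_base_lt_one hβ.1 hβ.2 hr0).2 hr1
    -- Because `b₃ ≤ γ₃ - γ₀`, the bound is a natural number `k`; as `β < 1`, `β ^ k ≤ ratio`, so
    -- step `k` itself is accepted.
    have hceil : 0 ≤ ⌈Real.logb β ratio⌉ := Int.ceil_nonneg hlog
    obtain ⟨k, hk⟩ := Int.eq_ofNat_of_zero_le hceil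
    rw [hk]
    have hkle : Real.logb β ratio ≤ k := by
      have := Int.le_ceil (Real.logb β ratio)
      rw [hk] at this
      exact_mod_cast this
    have hpow : β ^ k ≤ ratio := by
      rw [← Real.rpow_natCast]
      exact (Real.logb_le_iff_le_rpow_of_base_lt_one hβ.1 hβ.2 hr0).1 hkle
    exact_mod_cast hj.2 (hstep b₃ h0 hdesc k hpow)

end
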